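/- Let $K$ be a simplicial complex on the vertex set $[m]=\{1,\dots,m\}$ (with $\varnothing\in K$ and $\{i\}\in K$ for all $i$), let $\mathcal Z_K$ be its moment-angle complex, and for $I\subset[m]$ let $K_I=\{J\in K: J\subset I\}$ be the full subcomplex on $I$. By the Hochster decomposition the integral cohomology of $\mathcal Z_K$ is bigraded by $$H^{-k,2\ell}(\mathcal Z_K)=\bigoplus_{I\subset[m],\ |I|=\ell}\widetilde H^{\ell-k-1}(K_I;\mathbb Z),$$ where $\widetilde H^*$ is reduced simplicial cohomology (so $\widetilde H^{-1}(K_\varnothing)=\mathbb Z$). For $i\in I$ let $\psi_{p;i,I}\colon\widetilde H^p(K_I)\to\widetilde H^p(K_{I\setminus\{i\}})$ be induced by inclusion, let $\varepsilon(i,I)=(-1)^{\#\{r\in I:\,r<i\}}$, and let $d'\colon H^{-k,2\ell}(\mathcal Z_K)\to H^{-k+1,2\ell-2}(\mathcal Z_K)$ be the differential given on $\widetilde H^p(K_I)$ by $$d'=(-1)^{p+1}\sum_{i\in I}\varepsilon(i,I)\,\psi_{p;i,I}.$$ The bigraded double cohomology of $\mathcal Z_K$ is $HH^{*}(\mathcal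 Z_K)=H\bigl(H^*(\mathcal Z_K),d'\bigr)$. **Theorem.** Let $m\ge 5$ and let $L$ be an $m$-cycle, i.e. a cycle graph through all the vertices of $[m]$ (in any order), viewed as a one-dimensional simplicial complex. Then for all integers $k,\ell$ $$HH^{-k,2\ell}(\mathcal Z_L)\cong\begin{cases}\mathbb Z,&(-k,2\ell)\in\{(0,0),\ (-1,4),\ (-m+3,\,2(m-2)),\ (-m+2,\,2m)\},\\ 0,&\text{otherwise.}\end{cases}$$ In particular $HH^*(\mathcal Z_L)=\bigoplus_{k,\ell}HH^{-k,2\ell}(\mathcal Z_L)\cong\mathbb Z^4$. -/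

import Mathlib

namespace DoubleCoh

section Homology

variable {A B C : Type*} [AddCommGroup A] [AddCommGroup B] [AddCommGroup C]

/-- The homology `ker g / im f` of `A → B → C` at `B` (for `g ∘ f = 0`). -/
def Homology (f : A →ₗ[ℤ] B) (g : B →ₗ[ℤ] C) : Type _ :=
  LinearMap.ker g ⧸ (LinearMap.range f).submoduleOf (LinearMap.ker g)

instance (f : A →ₗ[ℤ] B) (g : B →ₗ[ℤ] C) : AddCommGroup (Homology f g) :=
  inferInstanceAs
    (AddCommGroup (LinearMap.ker g ⧸ (LinearMap.range f).submoduleOf (LinearMap.ker g)))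

/-- The homomorphism on homology induced by a commutative ladder. -/
def Homology.map {A' B' C' : Type*} [AddCommGroup A'] [AddCommGroup B'] [AddCommGroup C']
    {f : A →ₗ[ℤ] B} {g : B →ₗ[ℤ] C} {f' : A' →ₗ[ℤ] B'} {g' : B' →ₗ[ℤ] C'}
    (a : A →ₗ[ℤ] A') (b : B →ₗ[ℤ] B') (c : C →ₗ[ℤ] C')
    (hf : ∀ x, b (f x) = f' (a x)) (hg : ∀ x, c (g x) = g' (b x)) :
    Homology f g →ₗ[ℤ] Homology f' g' :=
  (Submodule.mapQ ((LinearMap.range f).submoduleOf (LinearMap.ker g))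
    ((LinearMap.range f').submoduleOf (LinearMap.ker g'))
    (b.restrict (p := LinearMap.ker g) (q := LinearMap.ker g') (by
      intro x hx
      rw [LinearMap.mem_ker] at hx ⊢
      rw [← hg, hx, map_zero]))
    (by
      rintro ⟨x, hx⟩ ⟨y, hy⟩
      exact ⟨a y, by
        rw [← hf, hy]
        rfl⟩)).toAddMonoidHom.toIntLinearMap

end Homology

variable {V : Type*} [LinearOrder V]

/-- The sign `ε(j, I) = (-1) ^ #{i ∈ I : i < j}`. -/
def eps (j : V) (I : Finset V) : ℤ :=
  (-1) ^ (I.filter (fun i => i < j)).card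

/-- The `p`-dimensional simplices of the full subcomplex `K_I`: the simplices of `K` with
`p + 1` elements that are contained in `I`. The empty set is the unique simplex of
dimension `-1` (Mathlib's complexes list only their nonempty simplices). -/
def Face (K : AbstractSimplicialComplex V) (I : Finset V) (p : ℤ) : Type _ :=
  {s : Finset V // (s = ∅ ∨ s ∈ K) ∧ s ⊆ I ∧ (s.card : ℤ) = p + 1}

/-- The facet `s \ {j}` of a simplex `s` of `K_I`, for `j ∈ s`. -/
def Face.erase {K : AbstractSimplicialComplex V} {I : Finset V} {p q : ℤ} (h : p + 1 = q)
    (s : Face K I q) (j : {j : V // j ∈ s.1}) : Face K I p :=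
  ⟨s.1.erase j.1, by
    obtain ⟨s, hs, hI, hc⟩ := s
    obtain ⟨j, hj⟩ := j
    refine ⟨?_, (Finset.erase_subset j s).trans hI, ?_⟩
    · rcases (s.erase j).eq_empty_or_nonempty with he | hne
      · exact Or.inl he
      · refine Or.inr ?_
        rcases hs with rfl | hs
        · simp at hj
        · exact (K.isRelLowerSet_faces hs).2 (Finset.erase_subset j s) hne
    · have h1 := Finset.card_erase_add_one hj
      simp only at h1 ⊢
      omega⟩

/-- A simplex of `K_J` regarded as a simplex of `K_I`, for `J ⊆ I`. -/
def Face.incl {K : AbstractSimplicialComplex V} {I J : Finset V} (hJ : J ⊆ I) {p : ℤ}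
    (s : Face K J p) : Face K I p :=
  ⟨s.1, s.2.1, s.2.2.1.trans hJ, s.2.2.2⟩

/-- The augmented simplicial cochain group `C^p(K_I)` with integer coefficients. -/
abbrev Cochain (K : AbstractSimplicialComplex V) (I : Finset V) (p : ℤ) : Type _ :=
  Face K I p → ℤ

/-- The simplicial coboundary `d : C^p(K_I) → C^q(K_I)`, where `q = p + 1`:
`(d f)(s) = ∑_{j ∈ s} ε(j, s) f(s \ {j})`. In terms of the cochains `α_L` dual to the
simplices `L`, it is `d α_L = ∑_j ε(j, L) α_{L ∪ {j}}`. -/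
def coboundary (K : AbstractSimplicialComplex V) (I : Finset V) {p q : ℤ} (h : p + 1 = q) :
    Cochain K I p →ₗ[ℤ] Cochain K I q where
  toFun f s := ∑ j : {j : V // j ∈ s.1}, eps j.1 s.1 * f (s.erase h j)
  map_add' f g := by
    funext s
    simp [mul_add, Finset.sum_add_distrib]
  map_smul' c f := by
    funext s
    simp [Finset.mul_sum, mul_left_comm]

/-- The reduced simplicial cohomology group `H̃^p(K_I)` with integer coefficients: the
cohomology of `C^{p-1}(K_I) → C^p(K_I) → C^{p+1}(K_I)` at the middle term. -/
abbrev RedCoh (K : AbstractSimplicialComplex V) (I : Finset V) (p : ℤ) : Type _ :=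
  Homology (coboundary K I (sub_add_cancel p 1)) (coboundary K I (rfl : p + 1 = p + 1))

/-- Restriction of cochains from `K_I` to `K_J`, for `J ⊆ I`. -/
def resCochain (K : AbstractSimplicialComplex V) {I J : Finset V} (hJ : J ⊆ I) (p : ℤ) :
    Cochain K I p →ₗ[ℤ] Cochain K J p :=
  LinearMap.funLeft ℤ ℤ (Face.incl hJ)

theorem resCochain_coboundary (K : AbstractSimplicialComplex V) {I J : Finset V} (hJ : J ⊆ I)
    {p q : ℤ} (h : p + 1 = q) (f : Cochain K I p) :
    resCochain K hJ q (coboundary K I h f) = coboundary K J h (resCochain K hJ p f) :=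
  rfl

/-- The homomorphism `H̃^p(K_I) → H̃^p(K_J)` induced by the inclusion `K_J ⊆ K_I`,
for `J ⊆ I`. -/
def resCoh (K : AbstractSimplicialComplex V) {I J : Finset V} (hJ : J ⊆ I) (p : ℤ) :
    RedCoh K I p →ₗ[ℤ] RedCoh K J p :=
  Homology.map (resCochain K hJ (p - 1)) (resCochain K hJ p) (resCochain K hJ (p + 1))
    (resCochain_coboundary K hJ _) (resCochain_coboundary K hJ _)

/-- The group `⨁_{|I| = ℓ} H̃^p(K_I)` (a finite direct sum). For `p = ℓ - k - 1` it is
the bigraded component `H^{-k, 2ℓ}` of the cohomology of the moment-angle complex of `K`. -/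
abbrev CH (K : AbstractSimplicialComplex V) (p ℓ : ℤ) : Type _ :=
  (I : {I : Finset V // (I.card : ℤ) = ℓ}) → RedCoh K I.1 p

variable [Fintype V]

/-- The differential `d' = (-1)^{p+1} ∑_{i ∈ I} ε(i, I) ψ_{p;i,I}`, where
`ψ_{p;i,I} : H̃^p(K_I) → H̃^p(K_{I \ {i}})` is the restriction, as a map
`⨁_{|I| = ℓ} H̃^p(K_I) → ⨁_{|J| = ℓ'} H̃^p(K_J)` with `ℓ' = ℓ - 1`. Its component at `J`
is the sum over the sets `I = J ∪ {i}` with `i ∉ J`. -/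
def dPrime (K : AbstractSimplicialComplex V) (p : ℤ) {ℓ ℓ' : ℤ} (h : ℓ' + 1 = ℓ) :
    CH K p ℓ →ₗ[ℤ] CH K p ℓ' :=
  LinearMap.pi fun J =>
    ((p + 1).negOnePow : ℤ) • ∑ i : {i : V // i ∉ J.1},
      eps i.1 (insert i.1 J.1) •
        (resCoh K (Finset.subset_insert i.1 J.1) p ∘ₗ
          LinearMap.proj (⟨insert i.1 J.1, by
            rw [Finset.card_insert_of_notMem i.2]
            have := J.2
            push_cast
            omega⟩ : {I : Finset V // (I.card : ℤ) = ℓ}))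

/-- The double cohomology group `HH^{-k, 2ℓ}` of the moment-angle complex of `K`: the
cohomology, with respect to `d'`, of
`H^{-k-1, 2ℓ+2} → H^{-k, 2ℓ} → H^{-k+1, 2ℓ-2}` at the middle term. -/
abbrev HH (K : AbstractSimplicialComplex V) (k ℓ : ℤ) : Type _ :=
  Homology (dPrime K (ℓ - k - 1) (rfl : ℓ + 1 = ℓ + 1))
    (dPrime K (ℓ - k - 1) (sub_add_cancel ℓ 1))

/-- A simplicial complex on `{1, …, m}` is an `m`-cycle if it is a cycle graph through all
`m` vertices (in any order), viewed as a 1-dimensional simplicial complex. -/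
def IsCycleComplex {m : ℕ} (L : AbstractSimplicialComplex (Fin m)) : Prop :=
  ∃ G : SimpleGraph (Fin m), Nonempty (G ≃g SimpleGraph.cycleGraph m) ∧
    L = Geometry.AbstractSimplicialComplex.ofSimpleGraph G

end DoubleCoh

/-! Fix `p`. The sign `(-1)^{p+1}` in `d'` changes neither kernels nor images, so the double
cohomology with `ℓ - k - 1 = p` is the homology, graded by `ℓ = |I|`, of the groups `H̃^p(K_I)`
under the signed sum of restrictions. The same differential acts on the cochains `C^p`, cocycles
`Z^p` and coboundaries `B^p` of all the `K_I`; write `h_ℓ` for the resulting homology.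

The family `C^p` is acyclic for `p + 1 < m` (`totExact_resCochain`): the values on one simplex `s`
form a Koszul complex over the sets `I ⊇ s`, contracted by any vertex outside `s`. Hence `0 → Z^p →
C^p → B^{p+1} → 0` gives `h_ℓ(B^{p+1}) ≅ h_{ℓ-1}(Z^p)`, and `0 → B^p → Z^p → H̃^p → 0` relates these
to the homology sought.

For an `m`-cycle both ends are explicit. From below, `Z^{-1}` lives only on the empty set, so
`h(Z^{-1})` is `ℤ` in degree 0; it equals `h(H̃^{-1})` and shifts to `h(B^0) = ℤ` in degree 1. From
above, `H̃^1(K_I)` is `ℤ` for `I = [m]` and zero otherwise, so `h(H̃^1)` is `ℤ` in degree `m`. As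
`B^2 = 0`, `Z^1` is acyclic, and two shifts give `h(Z^0) = ℤ` in degree `m - 2`
(`IsCycleEnum.cocycleHomology_zero_equiv`). The last sequence for `p = 0` then yields `ℤ` in degree
2, from `B^0`, and in degree `m - 2`, from `Z^0`; for `m ≥ 5` these degrees differ and nothing
interacts. -/

namespace DoubleCoh

/-! ### Homology groups of three-term complexes and their comparison -/

section Homology

variable {A B C A' B' C' : Type*} [AddCommGroup A] [AddCommGroup B] [AddCommGroup C]
  [AddCommGroup A'] [AddCommGroup B'] [AddCommGroup C']

/-- The class of a cycle. -/
def Homology.mk (f : A →ₗ[ℤ] B) (g : B →ₗ[ℤ] C) : LinearMap.ker g →+ Homology f g :=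
  ((LinearMap.range f).submoduleOf (LinearMap.ker g)).mkQ.toAddMonoidHom

theorem Homology.mk_surjective (f : A →ₗ[ℤ] B) (g : B →ₗ[ℤ] C) :
    Function.Surjective (Homology.mk f g) :=
  Submodule.mkQ_surjective _

theorem Homology.mk_eq_zero {f : A →ₗ[ℤ] B} {g : B →ₗ[ℤ] C} (x : LinearMap.ker g) :
    Homology.mk f g x = 0 ↔ ∃ y, f y = x := by
  refine (Submodule.Quotient.mk_eq_zero _).trans ?_
  rfl

theorem Homology.subsingleton_iff {f : A →ₗ[ℤ] B} {g : B →ₗ[ℤ] C} :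
    Subsingleton (Homology f g) ↔ ∀ x, g x = 0 → ∃ y, f y = x := by
  constructor
  · intro h x hx
    exact (Homology.mk_eq_zero ⟨x, hx⟩).1 (Subsingleton.elim _ _)
  · intro h
    refine subsingleton_of_forall_eq 0 fun z => ?_
    obtain ⟨x, rfl⟩ := Homology.mk_surjective f g z
    exact (Homology.mk_eq_zero x).2 (h x x.2)

/-- Two homology groups are isomorphic if an additive relation between cycles matches
cycles with cycles and boundaries with boundaries. -/
theorem Homology.nonempty_equiv_of_rel {f : A →ₗ[ℤ] B} {g : B →ₗ[ℤ] C} {f' : A' →ₗ[ℤ] B'}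
    {g' : B' →ₗ[ℤ] C'} (R : AddSubgroup (B × B'))
    (hl : ∀ x y, (x, y) ∈ R → g x = 0) (hr : ∀ x y, (x, y) ∈ R → g' y = 0)
    (el : ∀ x, g x = 0 → ∃ y, (x, y) ∈ R) (er : ∀ y, g' y = 0 → ∃ x, (x, y) ∈ R)
    (hb : ∀ x y, (x, y) ∈ R → ((∃ a, f a = x) ↔ ∃ a, f' a = y)) :
    Nonempty (Homology f g ≃ₗ[ℤ] Homology f' g') := by
  let F : R →+ Homology f g := (Homology.mk f g).comp
    { toFun r := ⟨r.1.1, hl _ r.1.2 r.2⟩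
      map_zero' := rfl
      map_add' _ _ := rfl }
  let F' : R →+ Homology f' g' := (Homology.mk f' g').comp
    { toFun r := ⟨r.1.2, hr r.1.1 _ r.2⟩
      map_zero' := rfl
      map_add' _ _ := rfl }
  have hF : Function.Surjective F := by
    intro z
    obtain ⟨x, rfl⟩ := Homology.mk_surjective f g z
    obtain ⟨y, hy⟩ := el x x.2
    exact ⟨⟨(x, y), hy⟩, rfl⟩
  have hF' : Function.Surjective F' := by
    intro z
    obtain ⟨y, rfl⟩ := Homology.mk_surjective f' g' z
    obtain ⟨x, hx⟩ := er y y.2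
    exact ⟨⟨(x, y), hx⟩, rfl⟩
  -- Both homology groups are quotients of `R`; by `hb` they are quotients by the same subgroup.
  have hk : F.ker = F'.ker := by
    ext r
    exact (Homology.mk_eq_zero (⟨r.1.1, hl _ _ r.2⟩ : LinearMap.ker g)).trans ((hb _ _ r.2).trans
      (Homology.mk_eq_zero (⟨r.1.2, hr _ _ r.2⟩ : LinearMap.ker g')).symm)
  exact ⟨((QuotientAddGroup.quotientKerEquivOfSurjective F hF).symm.trans
    ((QuotientAddGroup.quotientAddEquivOfEq hk).trans
      (QuotientAddGroup.quotientKerEquivOfSurjective F' hF'))).toIntLinearEquiv⟩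

theorem Homology.nonempty_equiv_of_iff {f : A →ₗ[ℤ] B} {g : B →ₗ[ℤ] C} {f' : A' →ₗ[ℤ] B}
    {g' : B →ₗ[ℤ] C'} (hg : ∀ x, g x = 0 ↔ g' x = 0)
    (hf : ∀ x, (∃ a, f a = x) ↔ ∃ a, f' a = x) :
    Nonempty (Homology f g ≃ₗ[ℤ] Homology f' g') := by
  refine Homology.nonempty_equiv_of_rel
    (((AddMonoidHom.fst B B) - (AddMonoidHom.snd B B)).ker.comap
      (AddMonoidHom.id _) ⊓ (g.toAddMonoidHom.comp (AddMonoidHom.fst B B)).ker) ?_ ?_ ?_ ?_ ?_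
  all_goals simp only [AddSubgroup.mem_inf, AddSubgroup.mem_comap, AddMonoidHom.mem_ker,
    AddMonoidHom.id_apply, AddMonoidHom.sub_apply, AddMonoidHom.comp_apply,
    AddMonoidHom.coe_fst, AddMonoidHom.coe_snd, LinearMap.toAddMonoidHom_coe, sub_eq_zero]
  · exact fun x y h => h.2
  · rintro x y ⟨rfl, h⟩
    exact (hg x).1 h
  · exact fun x h => ⟨x, rfl, h⟩
  · exact fun x h => ⟨x, rfl, (hg x).2 h⟩
  · rintro x y ⟨rfl, h⟩
    exact hf x

theorem Homology.nonempty_equiv_of_subsingleton [Subsingleton A] [Subsingleton C]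
    (f : A →ₗ[ℤ] B) (g : B →ₗ[ℤ] C) : Nonempty (Homology f g ≃ₗ[ℤ] B) := by
  refine ⟨(AddEquiv.ofBijective ((Homology.mk f g).comp
    { toFun x := ⟨x, Subsingleton.elim _ _⟩
      map_zero' := rfl
      map_add' _ _ := rfl } : B →+ Homology f g) ⟨?_, ?_⟩).toIntLinearEquiv.symm⟩
  · refine (injective_iff_map_eq_zero _).2 fun x hx => ?_
    obtain ⟨y, hy⟩ := (Homology.mk_eq_zero _).1 hx
    rw [Subsingleton.elim y 0, map_zero] at hy
    exact hy.symm
  · intro z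
    obtain ⟨x, rfl⟩ := Homology.mk_surjective f g z
    exact ⟨x, rfl⟩

end Homology

/-! ### Pieces of the long exact homology sequence -/

section ShortExact

variable {A₀ A₁ A₂ A₃ B₀ B₁ B₂ B₃ C₀ C₁ C₂ C₃ : Type*}
  [AddCommGroup A₀] [AddCommGroup A₁] [AddCommGroup A₂] [AddCommGroup A₃]
  [AddCommGroup B₀] [AddCommGroup B₁] [AddCommGroup B₂] [AddCommGroup B₃]
  [AddCommGroup C₀] [AddCommGroup C₁] [AddCommGroup C₂] [AddCommGroup C₃]
  {a₁ : A₁ →ₗ[ℤ] A₀} {a₂ : A₂ →ₗ[ℤ] A₁} {a₃ : A₃ →ₗ[ℤ] A₂}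
  {b₁ : B₁ →ₗ[ℤ] B₀} {b₂ : B₂ →ₗ[ℤ] B₁} {b₃ : B₃ →ₗ[ℤ] B₂}
  {c₁ : C₁ →ₗ[ℤ] C₀} {c₂ : C₂ →ₗ[ℤ] C₁} {c₃ : C₃ →ₗ[ℤ] C₂}
  {i₀ : A₀ →ₗ[ℤ] B₀} {i₁ : A₁ →ₗ[ℤ] B₁} {i₂ : A₂ →ₗ[ℤ] B₂} {i₃ : A₃ →ₗ[ℤ] B₃}
  {q₁ : B₁ →ₗ[ℤ] C₁} {q₂ : B₂ →ₗ[ℤ] C₂} {q₃ : B₃ →ₗ[ℤ] C₃}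

/-- The connecting homomorphism is an isomorphism if the middle complex is exact. -/
theorem Homology.nonempty_equiv_of_exact_middle
    (hi₀ : Function.Injective i₀) (hi₁ : Function.Injective i₁)
    (he₁ : Function.Exact i₁ q₁) (he₂ : Function.Exact i₂ q₂)
    (hq₂ : Function.Surjective q₂) (hq₃ : Function.Surjective q₃)
    (ia₁ : ∀ x, b₁ (i₁ x) = i₀ (a₁ x)) (ia₂ : ∀ x, b₂ (i₂ x) = i₁ (a₂ x))
    (qb₂ : ∀ x, q₁ (b₂ x) = c₂ (q₂ x)) (qb₃ : ∀ x, q₂ (b₃ x) = c₃ (q₃ x))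
    (bb₂ : ∀ x, b₁ (b₂ x) = 0) (bb₃ : ∀ x, b₂ (b₃ x) = 0)
    (hb₁ : ∀ x, b₁ x = 0 → ∃ y, b₂ y = x) (hb₂ : ∀ x, b₂ x = 0 → ∃ y, b₃ y = x) :
    Nonempty (Homology c₃ c₂ ≃ₗ[ℤ] Homology a₂ a₁) := by
  -- The snake relation: lift `x` to the middle complex, apply the differential, pull back to the
  -- subcomplex.
  let R : AddSubgroup (C₂ × A₁) :=
    { carrier := {z | ∃ b, q₂ b = z.1 ∧ b₂ b = i₁ z.2}
      zero_mem' := ⟨0, by simp, by simp⟩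
      add_mem' := by
        rintro _ _ ⟨b, h, h'⟩ ⟨b', k, k'⟩
        exact ⟨b + b', by simp [h, k], by simp [h', k']⟩
      neg_mem' := by
        rintro _ ⟨b, h, h'⟩
        exact ⟨-b, by simp [h], by simp [h']⟩ }
  refine Homology.nonempty_equiv_of_rel R ?_ ?_ ?_ ?_ ?_
  · rintro x y ⟨b, rfl : q₂ b = x, h : b₂ b = i₁ y⟩
    rw [← qb₂, h, he₁.apply_apply_eq_zero]
  · rintro x y ⟨b, rfl : q₂ b = x, h : b₂ b = i₁ y⟩
    apply hi₀
    rw [← ia₁, ← h, bb₂, map_zero]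
  · intro x hx
    obtain ⟨b, rfl⟩ := hq₂ x
    obtain ⟨y, hy⟩ := (he₁ (b₂ b)).1 (by rw [qb₂, hx])
    exact ⟨y, b, rfl, hy.symm⟩
  · intro y hy
    obtain ⟨b, hb⟩ := hb₁ (i₁ y) (by rw [ia₁, hy, map_zero])
    exact ⟨q₂ b, b, rfl, hb⟩
  · rintro x y ⟨b, rfl : q₂ b = x, h : b₂ b = i₁ y⟩
    constructor
    · rintro ⟨c, hc⟩
      obtain ⟨b', rfl⟩ := hq₃ c
      obtain ⟨a, ha⟩ := (he₂ (b - b₃ b')).1 (by rw [map_sub, qb₃, hc, sub_self])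
      refine ⟨a, hi₁ ?_⟩
      rw [← ia₂, ha, map_sub, bb₃, sub_zero, h]
    · rintro ⟨a, rfl⟩
      obtain ⟨b', hb'⟩ := hb₂ (b - i₂ a) (by rw [map_sub, h, ia₂, sub_self])
      refine ⟨q₃ b', ?_⟩
      rw [← qb₃, hb', map_sub, he₂.apply_apply_eq_zero, sub_zero]

/-- The quotient map is an isomorphism in homology if the subcomplex is exact. -/
theorem Homology.nonempty_equiv_of_exact_left
    (hi₀ : Function.Injective i₀) (hi₁ : Function.Injective i₁)
    (he₁ : Function.Exact i₁ q₁) (he₂ : Function.Exact i₂ q₂)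
    (hq₂ : Function.Surjective q₂) (hq₃ : Function.Surjective q₃)
    (ia₁ : ∀ x, b₁ (i₁ x) = i₀ (a₁ x)) (ia₂ : ∀ x, b₂ (i₂ x) = i₁ (a₂ x))
    (ia₃ : ∀ x, b₃ (i₃ x) = i₂ (a₃ x))
    (qb₂ : ∀ x, q₁ (b₂ x) = c₂ (q₂ x)) (qb₃ : ∀ x, q₂ (b₃ x) = c₃ (q₃ x))
    (bb₂ : ∀ x, b₁ (b₂ x) = 0) (bb₃ : ∀ x, b₂ (b₃ x) = 0)
    (ha₁ : ∀ x, a₁ x = 0 → ∃ y, a₂ y = x) (ha₂ : ∀ x, a₂ x = 0 → ∃ y, a₃ y = x) :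
    Nonempty (Homology b₃ b₂ ≃ₗ[ℤ] Homology c₃ c₂) := by
  let R : AddSubgroup (B₂ × C₂) :=
    { carrier := {z | q₂ z.1 = z.2 ∧ b₂ z.1 = 0}
      zero_mem' := ⟨by simp, by simp⟩
      add_mem' := by
        rintro _ _ ⟨h, h'⟩ ⟨k, k'⟩
        exact ⟨by simp [h, k], by simp [h', k']⟩
      neg_mem' := by
        rintro _ ⟨h, h'⟩
        exact ⟨by simp [h], by simp [h']⟩ }
  refine Homology.nonempty_equiv_of_rel R ?_ ?_ ?_ ?_ ?_
  · exact fun x y h => h.2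
  · rintro x y ⟨rfl : q₂ x = y, h : b₂ x = 0⟩
    rw [← qb₂, h, map_zero]
  · exact fun x hx => ⟨q₂ x, rfl, hx⟩
  · intro y hy
    obtain ⟨b, rfl⟩ := hq₂ y
    obtain ⟨a, ha⟩ := (he₁ (b₂ b)).1 (by rw [qb₂, hy])
    obtain ⟨a', rfl⟩ := ha₁ a (hi₀ (by rw [← ia₁, ha, bb₂, map_zero]))
    -- Exactness of the subcomplex corrects an arbitrary lift of a cycle to a lift that is itself a
    -- cycle.
    refine ⟨b - i₂ a', ?_, ?_⟩
    · change q₂ (b - i₂ a') = q₂ b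
      rw [map_sub, he₂.apply_apply_eq_zero, sub_zero]
    · change b₂ (b - i₂ a') = 0
      rw [map_sub, ia₂, ha, sub_self]
  · rintro x y ⟨rfl : q₂ x = y, h : b₂ x = 0⟩
    constructor
    · rintro ⟨b, rfl⟩
      exact ⟨q₃ b, (qb₃ b).symm⟩
    · rintro ⟨c, hc⟩
      obtain ⟨b, rfl⟩ := hq₃ c
      obtain ⟨a, ha⟩ := (he₂ (x - b₃ b)).1 (by rw [map_sub, qb₃, hc, sub_self])
      obtain ⟨a', rfl⟩ := ha₂ a (hi₁ (by rw [← ia₂, ha, map_sub, bb₃, h, sub_zero, map_zero]))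
      refine ⟨b + i₃ a', ?_⟩
      rw [map_add, ia₃, ha, add_sub_cancel]

/-- The quotient complex is exact where the middle complex and the shifted subcomplex are. -/
theorem Homology.exact_right
    (hi₀ : Function.Injective i₀)
    (he₁ : Function.Exact i₁ q₁) (he₂ : Function.Exact i₂ q₂)
    (hq₂ : Function.Surjective q₂)
    (ia₁ : ∀ x, b₁ (i₁ x) = i₀ (a₁ x)) (ia₂ : ∀ x, b₂ (i₂ x) = i₁ (a₂ x))
    (qb₂ : ∀ x, q₁ (b₂ x) = c₂ (q₂ x)) (qb₃ : ∀ x, q₂ (b₃ x) = c₃ (q₃ x))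
    (bb₂ : ∀ x, b₁ (b₂ x) = 0)
    (ha₁ : ∀ x, a₁ x = 0 → ∃ y, a₂ y = x) (hb₂ : ∀ x, b₂ x = 0 → ∃ y, b₃ y = x) :
    ∀ x, c₂ x = 0 → ∃ y, c₃ y = x := by
  intro x hx
  obtain ⟨b, rfl⟩ := hq₂ x
  obtain ⟨a, ha⟩ := (he₁ (b₂ b)).1 (by rw [qb₂, hx])
  obtain ⟨a', rfl⟩ := ha₁ a (hi₀ (by rw [← ia₁, ha, bb₂, map_zero]))
  obtain ⟨b', hb'⟩ := hb₂ (b - i₂ a') (by rw [map_sub, ia₂, ha, sub_self])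
  refine ⟨q₃ b', ?_⟩
  rw [← qb₃, hb', map_sub, he₂.apply_apply_eq_zero, sub_zero]

end ShortExact

/-! ### Families of groups indexed by vertex sets and their total complexes -/

section Total

variable {V : Type*}

/-- The product over the sets `I` with `|I| = ℓ` of a family of groups. -/
abbrev Tot (M : Finset V → Type*) (ℓ : ℤ) : Type _ :=
  (I : {I : Finset V // (I.card : ℤ) = ℓ}) → M I.1

variable {M N P : Finset V → Type*} [∀ I, AddCommGroup (M I)] [∀ I, AddCommGroup (N I)]
  [∀ I, AddCommGroup (P I)]

/-- A family of homomorphisms applied in every component. -/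
def totMap (φ : ∀ I, M I →ₗ[ℤ] N I) (ℓ : ℤ) : Tot M ℓ →ₗ[ℤ] Tot N ℓ where
  toFun f J := φ J.1 (f J)
  map_add' f g := by
    funext J
    simp
  map_smul' c f := by
    funext J
    simp

theorem totMap_injective {φ : ∀ I, M I →ₗ[ℤ] N I} (hφ : ∀ I, Function.Injective (φ I)) (ℓ : ℤ) :
    Function.Injective (totMap φ ℓ) :=
  fun _ _ h => funext fun J => hφ J.1 (congrFun h J)

theorem totMap_surjective {φ : ∀ I, M I →ₗ[ℤ] N I} (hφ : ∀ I, Function.Surjective (φ I)) (ℓ : ℤ) :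
    Function.Surjective (totMap φ ℓ) := by
  intro y
  choose x hx using fun J : {J : Finset V // (J.card : ℤ) = ℓ} => hφ J.1 (y J)
  exact ⟨x, funext hx⟩

theorem totMap_exact {φ : ∀ I, M I →ₗ[ℤ] N I} {ψ : ∀ I, N I →ₗ[ℤ] P I}
    (h : ∀ I, Function.Exact (φ I) (ψ I)) (ℓ : ℤ) :
    Function.Exact (totMap φ ℓ) (totMap ψ ℓ) := by
  intro y
  constructor
  · intro hy
    choose x hx using fun J : {J : Finset V // (J.card : ℤ) = ℓ} =>
      (h J.1 (y J)).1 (congrFun hy J)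
    exact ⟨x, funext hx⟩
  · rintro ⟨x, rfl⟩
    exact funext fun J => (h J.1).apply_apply_eq_zero _

variable [LinearOrder V]

/-- The set `J ∪ {i}`, with its cardinality. -/
def insertIdx {ℓ ℓ' : ℤ} (h : ℓ' + 1 = ℓ) (J : {J : Finset V // (J.card : ℤ) = ℓ'})
    (i : {i : V // i ∉ J.1}) : {I : Finset V // (I.card : ℤ) = ℓ} :=
  ⟨insert i.1 J.1, by
    rw [Finset.card_insert_of_notMem i.2]
    have := J.2
    push_cast
    omega⟩

variable [Fintype V]

/-- The signed sum of the restrictions from `J ∪ {i}` to `J`, for a family of groups with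
restriction homomorphisms. -/
def totD (res : ∀ {I J : Finset V}, J ⊆ I → M I →ₗ[ℤ] M J) {ℓ ℓ' : ℤ} (h : ℓ' + 1 = ℓ) :
    Tot M ℓ →ₗ[ℤ] Tot M ℓ' where
  toFun f J := ∑ i : {i : V // i ∉ J.1},
    eps i.1 (insert i.1 J.1) •
      res (I := (insertIdx h J i).1) (Finset.subset_insert i.1 J.1) (f (insertIdx h J i))
  map_add' f g := by
    funext J
    simp [Finset.sum_add_distrib]
  map_smul' c f := by
    funext J
    simp only [Pi.smul_apply, map_smul, RingHom.id_apply, Finset.smul_sum]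
    exact Finset.sum_congr rfl fun i _ => smul_comm _ _ _

theorem totMap_totD {resM : ∀ {I J : Finset V}, J ⊆ I → M I →ₗ[ℤ] M J}
    {resN : ∀ {I J : Finset V}, J ⊆ I → N I →ₗ[ℤ] N J} (φ : ∀ I, M I →ₗ[ℤ] N I)
    (hφ : ∀ {I J : Finset V} (hJ : J ⊆ I) (x : M I), φ J (resM hJ x) = resN hJ (φ I x))
    {ℓ ℓ' : ℤ} (h : ℓ' + 1 = ℓ) (x : Tot M ℓ) :
    totMap φ ℓ' (totD resM h x) = totD resN h (totMap φ ℓ x) := by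
  funext J
  simp only [totMap, totD, LinearMap.coe_mk, AddHom.coe_mk, map_sum, map_smul]
  exact Finset.sum_congr rfl fun i _ => congrArg (eps i.1 (insert i.1 J.1) • ·) (hφ _ _)

/-- The total complex is exact in degree `ℓ` (for all ways of writing `ℓ - 1` and `ℓ + 1`). -/
def TotExact (res : ∀ {I J : Finset V}, J ⊆ I → M I →ₗ[ℤ] M J) (ℓ : ℤ) : Prop :=
  ∀ x : Tot M ℓ, totD res (sub_add_cancel ℓ 1) x = 0 → ∃ y, totD res (rfl : ℓ + 1 = ℓ + 1) y = x

theorem TotExact.exists_eq {res : ∀ {I J : Finset V}, J ⊆ I → M I →ₗ[ℤ] M J} {ℓ : ℤ}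
    (H : TotExact res ℓ) {ℓ₀ ℓ₂ : ℤ} (h₀ : ℓ₀ + 1 = ℓ) (h₂ : ℓ + 1 = ℓ₂) (x : Tot M ℓ)
    (hx : totD res h₀ x = 0) : ∃ y, totD res h₂ y = x := by
  obtain rfl : ℓ₀ = ℓ - 1 := by omega
  subst h₂
  exact H x hx

/-- The homology of the total complex in degree `ℓ`. -/
abbrev TotHomology (res : ∀ {I J : Finset V}, J ⊆ I → M I →ₗ[ℤ] M J) (ℓ : ℤ) : Type _ :=
  Homology (totD res (rfl : ℓ + 1 = ℓ + 1)) (totD res (sub_add_cancel ℓ 1))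

theorem totExact_iff_subsingleton {res : ∀ {I J : Finset V}, J ⊆ I → M I →ₗ[ℤ] M J} {ℓ : ℤ} :
    TotExact res ℓ ↔ Subsingleton (TotHomology res ℓ) :=
  Homology.subsingleton_iff.symm

/-- The signed restrictions square to zero. -/
def TotSqZero (res : ∀ {I J : Finset V}, J ⊆ I → M I →ₗ[ℤ] M J) : Prop :=
  ∀ {ℓ₀ ℓ₁ ℓ₂ : ℤ} (h₁ : ℓ₀ + 1 = ℓ₁) (h₂ : ℓ₁ + 1 = ℓ₂) (x : Tot M ℓ₂),
    totD res h₁ (totD res h₂ x) = 0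

theorem TotSqZero.of_injective {resM : ∀ {I J : Finset V}, J ⊆ I → M I →ₗ[ℤ] M J}
    {resN : ∀ {I J : Finset V}, J ⊆ I → N I →ₗ[ℤ] N J} (φ : ∀ I, M I →ₗ[ℤ] N I)
    (hφ : ∀ {I J : Finset V} (hJ : J ⊆ I) (x : M I), φ J (resM hJ x) = resN hJ (φ I x))
    (hi : ∀ I, Function.Injective (φ I)) (H : TotSqZero resN) : TotSqZero resM := by
  intro ℓ₀ ℓ₁ ℓ₂ h₁ h₂ x
  apply totMap_injective hi
  rw [totMap_totD φ hφ, totMap_totD φ hφ, H, map_zero]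

section

variable {resM : ∀ {I J : Finset V}, J ⊆ I → M I →ₗ[ℤ] M J}
  {resN : ∀ {I J : Finset V}, J ⊆ I → N I →ₗ[ℤ] N J}
  {resP : ∀ {I J : Finset V}, J ⊆ I → P I →ₗ[ℤ] P J}
  {φ : ∀ I, M I →ₗ[ℤ] N I} {ψ : ∀ I, N I →ₗ[ℤ] P I}

theorem TotHomology.nonempty_equiv_of_exact_middle
    (hφ : ∀ {I J : Finset V} (hJ : J ⊆ I) (x : M I), φ J (resM hJ x) = resN hJ (φ I x))
    (hψ : ∀ {I J : Finset V} (hJ : J ⊆ I) (x : N I), ψ J (resN hJ x) = resP hJ (ψ I x))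
    (hi : ∀ I, Function.Injective (φ I)) (he : ∀ I, Function.Exact (φ I) (ψ I))
    (hs : ∀ I, Function.Surjective (ψ I)) (hN : TotSqZero resN) {ℓ ℓ' : ℤ} (h : ℓ' + 1 = ℓ)
    (e : TotExact resN ℓ) (e' : TotExact resN ℓ') :
    Nonempty (TotHomology resP ℓ ≃ₗ[ℤ] TotHomology resM ℓ') := by
  obtain rfl : ℓ' = ℓ - 1 := by omega
  obtain ⟨E⟩ := Homology.nonempty_equiv_of_exact_middle (totMap_injective hi _)
    (totMap_injective hi _) (totMap_exact he _) (totMap_exact he _) (totMap_surjective hs _)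
    (totMap_surjective hs _) (fun x => (totMap_totD φ hφ (sub_add_cancel (ℓ - 1) 1) x).symm)
    (fun x => (totMap_totD φ hφ (sub_add_cancel ℓ 1) x).symm) (totMap_totD ψ hψ (sub_add_cancel ℓ 1))
    (totMap_totD ψ hψ (rfl : ℓ + 1 = ℓ + 1)) (hN _ _) (hN _ _) (e'.exists_eq _ _) e
  -- The incoming differential found so far starts in degree `ℓ`, while `TotHomology resM (ℓ - 1)`
  -- uses `ℓ - 1 + 1`, which is equal only propositionally; `F` bridges the two.
  obtain ⟨F⟩ := Homology.nonempty_equiv_of_iff (f := totD resM (sub_add_cancel ℓ 1))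
    (f' := totD resM (rfl : ℓ - 1 + 1 = ℓ - 1 + 1)) (g := totD resM (sub_add_cancel (ℓ - 1) 1))
    (fun _ => Iff.rfl) (fun x => by
      have : ∀ k (hk : ℓ - 1 + 1 = k), (∃ a, totD resM hk a = x) ↔
        ∃ a, totD resM (rfl : ℓ - 1 + 1 = ℓ - 1 + 1) a = x := by
        rintro k rfl
        rfl
      exact this _ _)
  exact ⟨E.trans F⟩

theorem TotHomology.nonempty_equiv_of_exact_left
    (hφ : ∀ {I J : Finset V} (hJ : J ⊆ I) (x : M I), φ J (resM hJ x) = resN hJ (φ I x))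
    (hψ : ∀ {I J : Finset V} (hJ : J ⊆ I) (x : N I), ψ J (resN hJ x) = resP hJ (ψ I x))
    (hi : ∀ I, Function.Injective (φ I)) (he : ∀ I, Function.Exact (φ I) (ψ I))
    (hs : ∀ I, Function.Surjective (ψ I)) (hN : TotSqZero resN) {ℓ : ℤ}
    (e : TotExact resM ℓ) (e' : TotExact resM (ℓ - 1)) :
    Nonempty (TotHomology resN ℓ ≃ₗ[ℤ] TotHomology resP ℓ) :=
  Homology.nonempty_equiv_of_exact_left (totMap_injective hi _)
    (totMap_injective hi _) (totMap_exact he _) (totMap_exact he _) (totMap_surjective hs _)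
    (totMap_surjective hs _) (fun x => (totMap_totD φ hφ (sub_add_cancel (ℓ - 1) 1) x).symm)
    (fun x => (totMap_totD φ hφ _ x).symm) (fun x => (totMap_totD φ hφ _ x).symm) (totMap_totD ψ hψ _)
    (totMap_totD ψ hψ _) (hN _ _) (hN _ _) (e'.exists_eq _ _) e

theorem TotExact.right
    (hφ : ∀ {I J : Finset V} (hJ : J ⊆ I) (x : M I), φ J (resM hJ x) = resN hJ (φ I x))
    (hψ : ∀ {I J : Finset V} (hJ : J ⊆ I) (x : N I), ψ J (resN hJ x) = resP hJ (ψ I x))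
    (hi : ∀ I, Function.Injective (φ I)) (he : ∀ I, Function.Exact (φ I) (ψ I))
    (hs : ∀ I, Function.Surjective (ψ I)) (hN : TotSqZero resN) {ℓ : ℤ}
    (e : TotExact resN ℓ) (e' : TotExact resM (ℓ - 1)) : TotExact resP ℓ :=
  Homology.exact_right (totMap_injective hi _)
    (totMap_exact he _) (totMap_exact he _) (totMap_surjective hs _)
    (fun x => (totMap_totD φ hφ (sub_add_cancel (ℓ - 1) 1) x).symm)
    (fun x => (totMap_totD φ hφ _ x).symm) (totMap_totD ψ hψ _)
    (totMap_totD ψ hψ _) (hN _ _) (e'.exists_eq _ _) e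

end

/-- The homology of a family of groups concentrated on one set `I₀`. -/
theorem TotHomology.nonempty_equiv_of_concentrated
    (res : ∀ {I J : Finset V}, J ⊆ I → M I →ₗ[ℤ] M J) {ℓ : ℤ} (I₀ : Finset V)
    (h₀ : (I₀.card : ℤ) = ℓ) (hM : ∀ I, I ≠ I₀ → Subsingleton (M I)) :
    Nonempty (TotHomology res ℓ ≃ₗ[ℤ] M I₀) := by
  have hs : ∀ k, k ≠ ℓ → Subsingleton (Tot M k) := fun k hk =>
    ⟨fun f g => funext fun J => (hM J.1 (by rintro h; exact hk (by rw [← J.2, h, h₀]))).elim _ _⟩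
  have := hs (ℓ + 1) (by omega)
  have := hs (ℓ - 1) (by omega)
  obtain ⟨E⟩ := Homology.nonempty_equiv_of_subsingleton (totD res (rfl : ℓ + 1 = ℓ + 1))
    (totD res (sub_add_cancel ℓ 1))
  refine ⟨E.trans (AddEquiv.ofBijective
    ({ toFun f := f ⟨I₀, h₀⟩, map_zero' := rfl, map_add' _ _ := rfl } : Tot M ℓ →+ M I₀)
    ⟨?_, ?_⟩).toIntLinearEquiv⟩
  · refine (injective_iff_map_eq_zero _).2 fun f hf => funext fun J => ?_
    obtain ⟨J, hJ⟩ := J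
    rcases eq_or_ne J I₀ with rfl | hne
    · exact hf
    · exact (hM J hne).elim _ _
  · classical
    intro x
    refine ⟨fun J => if h : J.1 = I₀ then h ▸ x else 0, ?_⟩
    simp

theorem totExact_of_subsingleton (res : ∀ {I J : Finset V}, J ⊆ I → M I →ₗ[ℤ] M J) {ℓ : ℤ}
    (hM : ∀ I : Finset V, (I.card : ℤ) = ℓ → Subsingleton (M I)) : TotExact res ℓ :=
  fun _ _ => ⟨0, funext fun J => (hM J.1 J.2).elim _ _⟩

end Total

/-! ### The Koszul differential and its contraction -/

section Koszul

variable {V : Type*} [LinearOrder V]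

theorem eps_mul_self (i : V) (I : Finset V) : eps i I * eps i I = 1 := by
  rw [eps, ← mul_pow]
  simp

theorem eps_insert_self (i : V) (I : Finset V) : eps i (insert i I) = eps i I := by
  simp [eps, Finset.filter_insert]

theorem eps_insert (i : V) {j : V} {I : Finset V} (hj : j ∉ I) :
    eps i (insert j I) = if j < i then -eps i I else eps i I := by
  unfold eps
  rw [Finset.filter_insert]
  split_ifs
  · rw [Finset.card_insert_of_notMem (by simp [hj]), pow_succ, mul_neg_one]
  · rfl

variable [Fintype V]

/-- The Koszul differential on functions on the sets of vertices. -/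
def koszulD (F : Finset V → ℤ) (J : Finset V) : ℤ :=
  ∑ i : V, if i ∈ J then 0 else eps i J * F (insert i J)

theorem koszulD_eq_sum_subtype (F : Finset V → ℤ) (J : Finset V) :
    koszulD F J = ∑ i : {i : V // i ∉ J}, eps i.1 (insert i.1 J) * F (insert i.1 J) := by
  rw [koszulD, ← Finset.sum_subtype (Finset.univ.filter (· ∉ J)) (by simp)
    (fun i => eps i (insert i J) * F (insert i J)), Finset.sum_filter]
  simp only [eps_insert_self, ite_not]

/-- Inserting `i` and then `j` cancels against `j` and then `i`: exactly one of the two orders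
inserts the smaller vertex first and picks up an extra sign. -/
theorem koszulD_koszulD (F : Finset V → ℤ) (J : Finset V) :
    koszulD (koszulD F) J = 0 := by
  let g : V → V → ℤ := fun i j =>
    if i ∈ J ∨ j ∈ insert i J then 0 else eps i J * (eps j (insert i J) * F (insert j (insert i J)))
  have hg : ∀ i j, g i j = -g j i := by
    intro i j
    simp only [g, Finset.mem_insert]
    by_cases hi : i ∈ J
    · simp [hi]
    by_cases hj : j ∈ J
    · simp [hj]
    rcases lt_trichotomy i j with h | rfl | h
    · simp only [hi, hj, h.ne, h.ne', or_self, if_false, eps_insert _ hi, eps_insert _ hj, h,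
        h.not_gt, if_true, Finset.insert_comm i j]
      ring
    · simp
    · simp only [hi, hj, h.ne, h.ne', or_self, if_false, eps_insert _ hi, eps_insert _ hj, h,
        h.not_gt, if_true, Finset.insert_comm i j]
      ring
  have h1 : koszulD (koszulD F) J = ∑ i, ∑ j, g i j := by
    refine Finset.sum_congr rfl fun i _ => ?_
    by_cases hi : i ∈ J
    · simp [hi, g]
    · simp only [hi, if_false, koszulD, Finset.mul_sum, g, false_or, mul_ite, mul_zero]
  have h2 : ∑ i, ∑ j, g i j = -∑ i, ∑ j, g i j := by
    conv_lhs => rw [Finset.sum_comm]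
    simp_rw [← Finset.sum_neg_distrib]
    exact Finset.sum_congr rfl fun i _ => Finset.sum_congr rfl fun j _ => hg j i
  rw [h1]
  omega

/-- The contracting homotopy of the Koszul differential given by a vertex `w`. -/
def koszulH (w : V) (F : Finset V → ℤ) (I : Finset V) : ℤ :=
  if w ∈ I then eps w I * F (I.erase w) else 0

/-- If `w ∉ J`, only the term `i = w` survives. If `w ∈ J`, the sum is, up to the factor `-eps w`,
the part of `koszulD F (J.erase w)` with `i ≠ w`, so the cycle condition at this one set trades it
for the term in `F J`. The local form of the hypothesis matters because cycles are only controlled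
on sets containing a given simplex. -/
theorem koszulD_koszulH (w : V) (F : Finset V → ℤ) (J : Finset V)
    (h : w ∈ J → koszulD F (J.erase w) = 0) : koszulD (koszulH w F) J = F J := by
  by_cases hw : w ∈ J
  · obtain ⟨I, hwI, rfl⟩ : ∃ I, w ∉ I ∧ insert w I = J :=
      ⟨J.erase w, Finset.notMem_erase w J, Finset.insert_erase hw⟩
    replace h := h hw
    rw [Finset.erase_insert hwI, koszulD, ← Finset.add_sum_erase _ _ (Finset.mem_univ w)] at h
    rw [koszulD, ← Finset.add_sum_erase _ _ (Finset.mem_univ w), if_pos hw, zero_add]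
    rw [if_neg hwI] at h
    have key : ∀ i ∈ Finset.univ.erase w, (if i ∈ insert w I then 0
        else eps i (insert w I) * koszulH w F (insert i (insert w I))) =
        -eps w I * (if i ∈ I then 0 else eps i I * F (insert i I)) := by
      intro i hi
      have hiw : i ≠ w := Finset.ne_of_mem_erase hi
      by_cases hiI : i ∈ I
      · simp [hiI]
      have hwi : w ∉ insert i I := by simp [hwI, hiw.symm]
      rw [if_neg (by simp [hiw, hiI]), if_neg hiI, koszulH, if_pos (by simp),
        Finset.insert_comm i w, Finset.erase_insert hwi, eps_insert_self, eps_insert _ hwI,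
        eps_insert _ hiI]
      rcases hiw.lt_or_gt with hlt | hlt
      · simp only [hlt, hlt.not_gt, if_true, if_false]
        ring
      · simp only [hlt, hlt.not_gt, if_true, if_false]
        ring
    rw [Finset.sum_congr rfl key, ← Finset.mul_sum, ← add_eq_zero_iff_neg_eq.1 h]
    linear_combination F (insert w I) * eps_mul_self w I
  · rw [koszulD, Finset.sum_eq_single w]
    · rw [if_neg hw, koszulH, if_pos (by simp), Finset.erase_insert hw, eps_insert_self,
        ← mul_assoc, eps_mul_self, one_mul]
    · intro i _ hi
      have : w ∉ insert i J := by simp [hw, hi.symm]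
      rw [koszulH, if_neg this, mul_zero, ite_self]
    · simp

end Koszul

/-! ### Acyclicity of the family of cochain groups -/

section CochainTot

variable {V : Type*} [LinearOrder V] {K : AbstractSimplicialComplex V} {p : ℤ}

/-- The values on a fixed simplex of a family of cochains, extended by zero. -/
noncomputable def Tot.faceExt {ℓ : ℤ} (f : Tot (fun I => Cochain K I p) ℓ) (s I : Finset V) : ℤ :=
  open Classical in
  if h : (I.card : ℤ) = ℓ ∧ (s = ∅ ∨ s ∈ K) ∧ s ⊆ I ∧ (s.card : ℤ) = p + 1 then
    f ⟨I, h.1⟩ ⟨s, h.2⟩ else 0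

theorem Tot.faceExt_apply {ℓ : ℤ} (f : Tot (fun I => Cochain K I p) ℓ)
    (J : {I : Finset V // (I.card : ℤ) = ℓ}) (s : Face K J.1 p) :
    f.faceExt s.1 J.1 = f J s :=
  dif_pos ⟨J.2, s.2⟩

variable [Fintype V]

theorem totD_resCochain_apply {ℓ ℓ' : ℤ} (h : ℓ' + 1 = ℓ) (f : Tot (fun I => Cochain K I p) ℓ)
    (J : {I : Finset V // (I.card : ℤ) = ℓ'}) (s : Face K J.1 p) :
    totD (fun hJ => resCochain K hJ p) h f J s =
      ∑ i : {i : V // i ∉ J.1}, eps i.1 (insert i.1 J.1) *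
        f (insertIdx h J i) (s.incl (Finset.subset_insert i.1 J.1)) := by
  simp only [totD, LinearMap.coe_mk, AddHom.coe_mk, Finset.sum_apply]
  rfl

theorem totD_resCochain_eq_koszulD {ℓ ℓ' : ℤ} (h : ℓ' + 1 = ℓ)
    (f : Tot (fun I => Cochain K I p) ℓ)
    (J : {I : Finset V // (I.card : ℤ) = ℓ'}) (s : Face K J.1 p) :
    totD (fun hJ => resCochain K hJ p) h f J s = koszulD (f.faceExt s.1) J.1 := by
  rw [totD_resCochain_apply, koszulD_eq_sum_subtype]
  refine Finset.sum_congr rfl fun i _ => congrArg _ ?_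
  exact (f.faceExt_apply (insertIdx h J i) (s.incl (Finset.subset_insert i.1 J.1))).symm

theorem totSqZero_resCochain :
    TotSqZero (M := fun I => Cochain K I p) (fun hJ => resCochain K hJ p) := by
  intro ℓ₀ ℓ₁ ℓ₂ h₁ h₂ f
  funext J s
  rw [totD_resCochain_apply]
  refine Eq.trans ?_ (koszulD_koszulD (f.faceExt s.1) J.1)
  rw [koszulD_eq_sum_subtype]
  exact Finset.sum_congr rfl fun i _ => congrArg _ (totD_resCochain_eq_koszulD h₂ f
    (insertIdx h₁ J i) (s.incl (Finset.subset_insert i.1 J.1)))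

/-- The restrictions never change the simplex, so the complex splits over the simplices `s`. The
bound on `p` leaves a vertex `w ∉ s`, possibly different for each `s`, which contracts the summand
of `s`. -/
theorem totExact_resCochain (hp : p + 1 < Fintype.card V) (ℓ : ℤ) :
    TotExact (M := fun I => Cochain K I p) (fun hJ => resCochain K hJ p) ℓ := by
  intro f hf
  have hw : ∀ s : Finset V, (s.card : ℤ) = p + 1 → ∃ w, w ∉ s := by
    intro s hs
    by_contra! h
    rw [Finset.eq_univ_of_forall h, Finset.card_univ] at hs
    omega
  choose w hw using hw
  refine ⟨fun I s => koszulH (w s.1 s.2.2.2) (f.faceExt s.1) I.1, ?_⟩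
  funext J s
  have hws := hw s.1 s.2.2.2
  rw [totD_resCochain_apply, ← f.faceExt_apply J s,
    ← koszulD_koszulH (w s.1 s.2.2.2) (f.faceExt s.1) J.1, koszulD_eq_sum_subtype]
  · rfl
  · intro hwJ
    have hc : ((J.1.erase (w s.1 s.2.2.2)).card : ℤ) = ℓ - 1 := by
      have h1 := Finset.card_erase_add_one hwJ
      have := J.2
      omega
    -- Since `w ∉ s`, the simplex `s` still lies in `J` without `w`, so the cycle condition on `f`
    -- can be read off there.
    have := totD_resCochain_eq_koszulD (sub_add_cancel ℓ 1) f ⟨_, hc⟩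
      ⟨s.1, s.2.1, fun x hx => Finset.mem_erase.2 ⟨by rintro rfl; exact hws hx, s.2.2.1 hx⟩,
        s.2.2.2⟩
    rw [← this, hf]
    rfl

end CochainTot

/-! ### Cocycles, coboundaries and the two short exact sequences -/

section Coboundary

variable {V : Type*} [LinearOrder V] {K : AbstractSimplicialComplex V} {I J : Finset V} {p q r : ℤ}

theorem coboundary_apply (h : p + 1 = q) (f : Cochain K I p) (s : Face K I q) :
    coboundary K I h f s = ∑ j : {j : V // j ∈ s.1}, eps j.1 s.1 * f (s.erase h j) :=
  rfl

theorem eps_erase (i : V) {j : V} {I : Finset V} (hj : j ∈ I) :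
    eps i (I.erase j) = if j < i then -eps i I else eps i I := by
  have h := eps_insert i (Finset.notMem_erase j I)
  rw [Finset.insert_erase hj] at h
  split_ifs at h ⊢
  · rw [h, neg_neg]
  · exact h.symm

/-- A simplex of `K_I` with its properties. -/
def Face.of (s : Finset V) (h : (s = ∅ ∨ s ∈ K) ∧ s ⊆ I ∧ (s.card : ℤ) = p + 1) : Face K I p :=
  ⟨s, h⟩

/-- The values of a cochain, extended by zero. -/
noncomputable def Cochain.ext (f : Cochain K I p) (s : Finset V) : ℤ :=
  open Classical in
  if h : (s = ∅ ∨ s ∈ K) ∧ s ⊆ I ∧ (s.card : ℤ) = p + 1 then f (Face.of s h) else 0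

theorem Cochain.ext_apply (f : Cochain K I p) (s : Face K I p) : Cochain.ext f s.1 = f s :=
  dif_pos s.2

theorem coboundary_apply_eq_sum (h : p + 1 = q) (f : Cochain K I p) (s : Face K I q) :
    coboundary K I h f s = ∑ j ∈ s.1, eps j s.1 * Cochain.ext f (s.1.erase j) := by
  rw [coboundary_apply, Finset.sum_subtype s.1 (p := fun j => j ∈ s.1) (fun _ => Iff.rfl)]
  exact Finset.sum_congr rfl fun j _ => congrArg _ (Cochain.ext_apply f (s.erase h j)).symm

theorem coboundary_coboundary (h : p + 1 = q) (h' : q + 1 = r) (f : Cochain K I p) :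
    coboundary K I h' (coboundary K I h f) = 0 := by
  funext s
  let F := Cochain.ext f
  let g : V → V → ℤ := fun i j =>
    if i = j then 0 else eps i s.1 * (eps j (s.1.erase i) * F ((s.1.erase i).erase j))
  have hg : ∀ i ∈ s.1, ∀ j ∈ s.1, g i j = -g j i := by
    intro i hi j hj
    simp only [g]
    rcases lt_trichotomy i j with h | rfl | h
    · simp only [h.ne, h.ne', if_false, eps_erase _ hi, eps_erase _ hj, h,
        h.not_gt, if_true, Finset.erase_right_comm (a := i) (b := j)]
      ring
    · simp
    · simp only [h.ne, h.ne', if_false, eps_erase _ hi, eps_erase _ hj, h,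
        h.not_gt, if_true, Finset.erase_right_comm (a := i) (b := j)]
      ring
  have h1 : coboundary K I h' (coboundary K I h f) s = ∑ i ∈ s.1, ∑ j ∈ s.1, g i j := by
    rw [coboundary_apply, Finset.sum_subtype s.1 (p := fun j => j ∈ s.1) (fun _ => Iff.rfl)]
    refine Finset.sum_congr rfl fun i _ => ?_
    rw [coboundary_apply_eq_sum, Finset.mul_sum, ← Finset.add_sum_erase _ _ i.2]
    have hgi : g i.1 i.1 = 0 := if_pos rfl
    rw [hgi, zero_add]
    refine Finset.sum_congr rfl fun j hj => ?_
    simp only [g]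
    rw [if_neg (Finset.ne_of_mem_erase hj).symm]
    rfl
  have h2 : ∑ i ∈ s.1, ∑ j ∈ s.1, g i j = -∑ i ∈ s.1, ∑ j ∈ s.1, g i j := by
    conv_lhs => rw [Finset.sum_comm]
    simp_rw [← Finset.sum_neg_distrib]
    exact Finset.sum_congr rfl fun i hi => Finset.sum_congr rfl fun j hj => hg j hj i hi
  rw [h1, Pi.zero_apply]
  omega

variable (K I p) in
/-- The simplicial cocycles of `K_I`. -/
abbrev cocycles : Submodule ℤ (Cochain K I p) :=
  LinearMap.ker (coboundary K I (rfl : p + 1 = p + 1))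

variable (K I p) in
/-- The simplicial coboundaries of `K_I`. -/
abbrev coboundaries : Submodule ℤ (Cochain K I p) :=
  LinearMap.range (coboundary K I (sub_add_cancel p 1))

theorem coboundary_eq_zero_iff (h : p + 1 = q) (f : Cochain K I p) :
    coboundary K I h f = 0 ↔ f ∈ cocycles K I p := by
  subst h
  rfl

theorem mem_coboundaries_iff (h : p + 1 = q) (f : Cochain K I q) :
    f ∈ coboundaries K I q ↔ ∃ g, coboundary K I h g = f := by
  obtain rfl : p = q - 1 := by omega
  rfl

theorem coboundaries_le_cocycles : coboundaries K I p ≤ cocycles K I p := by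
  rintro _ ⟨g, rfl⟩
  exact coboundary_coboundary _ _ g

/-- Restriction of cocycles. -/
def resCocycles (hJ : J ⊆ I) (p : ℤ) : cocycles K I p →ₗ[ℤ] cocycles K J p :=
  (resCochain K hJ p).restrict (p := cocycles K I p) (q := cocycles K J p) fun x hx => by
    rw [LinearMap.mem_ker] at hx ⊢
    rw [← resCochain_coboundary, hx, map_zero]

/-- Restriction of coboundaries. -/
def resCoboundaries (hJ : J ⊆ I) (p : ℤ) : coboundaries K I p →ₗ[ℤ] coboundaries K J p :=
  (resCochain K hJ p).restrict (p := coboundaries K I p) (q := coboundaries K J p) <| by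
    rintro _ ⟨g, rfl⟩
    exact ⟨_, (resCochain_coboundary K hJ _ g).symm⟩

variable (K I) in
/-- The coboundary, as a map onto the coboundaries. -/
def toCoboundaries (h : p + 1 = q) : Cochain K I p →ₗ[ℤ] coboundaries K I q :=
  (coboundary K I h).codRestrict _ fun x => (mem_coboundaries_iff h _).2 ⟨x, rfl⟩

theorem toCoboundaries_surjective (h : p + 1 = q) : Function.Surjective (toCoboundaries K I h) := by
  rintro ⟨f, hf⟩
  obtain ⟨g, rfl⟩ := (mem_coboundaries_iff h f).1 hf
  exact ⟨g, rfl⟩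

theorem exact_subtype_toCoboundaries (h : p + 1 = q) :
    Function.Exact (cocycles K I p).subtype (toCoboundaries K I h) := by
  intro f
  rw [Subtype.ext_iff]
  refine (coboundary_eq_zero_iff h f).trans ?_
  simp

/-- The cohomology class of a cocycle. -/
def toRedCoh : cocycles K I p →ₗ[ℤ] RedCoh K I p :=
  (Homology.mk _ _).toIntLinearMap

theorem toRedCoh_surjective :
    Function.Surjective (toRedCoh : cocycles K I p →ₗ[ℤ] RedCoh K I p) :=
  Homology.mk_surjective _ _

theorem exact_inclusion_toRedCoh :
    Function.Exact (Submodule.inclusion coboundaries_le_cocycles)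
      (toRedCoh : cocycles K I p →ₗ[ℤ] RedCoh K I p) := by
  intro f
  refine (Homology.mk_eq_zero f).trans ?_
  constructor
  · rintro ⟨g, hg⟩
    exact ⟨⟨f, g, hg⟩, rfl⟩
  · rintro ⟨⟨_, g, rfl⟩, rfl⟩
    exact ⟨g, rfl⟩

end Coboundary

/-! ### Homology of the families of cocycles, coboundaries and cohomology groups -/

section DoubleComplex

variable {V : Type*} [LinearOrder V] [Fintype V] (K : AbstractSimplicialComplex V) (p : ℤ)

/-- The homology of the family of cocycle groups. -/
abbrev CocycleHomology (ℓ : ℤ) : Type _ :=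
  TotHomology (M := fun I => cocycles K I p) (fun hJ => resCocycles hJ p) ℓ

/-- The homology of the family of coboundary groups. -/
abbrev CoboundaryHomology (ℓ : ℤ) : Type _ :=
  TotHomology (M := fun I => coboundaries K I p) (fun hJ => resCoboundaries hJ p) ℓ

/-- The homology of the family of reduced cohomology groups. -/
abbrev RedCohHomology (ℓ : ℤ) : Type _ :=
  TotHomology (M := fun I => RedCoh K I p) (fun hJ => resCoh K hJ p) ℓ

variable {K p}

theorem totSqZero_resCocycles :
    TotSqZero (M := fun I => cocycles K I p) (fun hJ => resCocycles hJ p) :=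
  totSqZero_resCochain.of_injective (fun I => (cocycles K I p).subtype) (fun _ _ => rfl)
    (fun _ => Subtype.val_injective)

/-- The connecting map of `0 → Z^p → C^p → B^{p+1} → 0`, whose middle term is acyclic. -/
theorem CoboundaryHomology.nonempty_equiv_cocycleHomology {q ℓ ℓ' : ℤ} (h : p + 1 = q)
    (hp : p + 1 < Fintype.card V) (hℓ : ℓ' + 1 = ℓ) :
    Nonempty (CoboundaryHomology K q ℓ ≃ₗ[ℤ] CocycleHomology K p ℓ') :=
  TotHomology.nonempty_equiv_of_exact_middle (resN := fun hJ => resCochain K hJ p)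
    (φ := fun I => (cocycles K I p).subtype) (ψ := fun I => toCoboundaries K I h)
    (fun _ _ => rfl) (fun _ _ => rfl) (fun _ => Subtype.val_injective)
    (fun _ => exact_subtype_toCoboundaries h) (fun _ => toCoboundaries_surjective h)
    totSqZero_resCochain hℓ (totExact_resCochain hp _) (totExact_resCochain hp _)

/-- In `0 → B^p → Z^p → H̃^p → 0`, the projection is an isomorphism on homology where `B^p` is
acyclic. -/
theorem RedCohHomology.nonempty_equiv_cocycleHomology {ℓ : ℤ}
    (h : Subsingleton (CoboundaryHomology K p ℓ))
    (h' : Subsingleton (CoboundaryHomology K p (ℓ - 1))) :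
    Nonempty (CocycleHomology K p ℓ ≃ₗ[ℤ] RedCohHomology K p ℓ) :=
  TotHomology.nonempty_equiv_of_exact_left
    (φ := fun _ => Submodule.inclusion coboundaries_le_cocycles) (ψ := fun _ => toRedCoh)
    (fun _ _ => rfl) (fun _ _ => rfl) (fun _ => Submodule.inclusion_injective _)
    (fun _ => exact_inclusion_toRedCoh) (fun _ => toRedCoh_surjective)
    totSqZero_resCocycles (totExact_iff_subsingleton.2 h) (totExact_iff_subsingleton.2 h')

/-- In the same sequence, the connecting map is an isomorphism where `Z^p` is acyclic. -/
theorem RedCohHomology.nonempty_equiv_coboundaryHomology {ℓ ℓ' : ℤ} (hℓ : ℓ' + 1 = ℓ)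
    (h : Subsingleton (CocycleHomology K p ℓ)) (h' : Subsingleton (CocycleHomology K p ℓ')) :
    Nonempty (RedCohHomology K p ℓ ≃ₗ[ℤ] CoboundaryHomology K p ℓ') :=
  TotHomology.nonempty_equiv_of_exact_middle
    (φ := fun _ => Submodule.inclusion coboundaries_le_cocycles) (ψ := fun _ => toRedCoh)
    (fun _ _ => rfl) (fun _ _ => rfl) (fun _ => Submodule.inclusion_injective _)
    (fun _ => exact_inclusion_toRedCoh) (fun _ => toRedCoh_surjective)
    totSqZero_resCocycles hℓ (totExact_iff_subsingleton.2 h) (totExact_iff_subsingleton.2 h')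

theorem RedCohHomology.subsingleton {ℓ : ℤ} (h : Subsingleton (CocycleHomology K p ℓ))
    (h' : Subsingleton (CoboundaryHomology K p (ℓ - 1))) :
    Subsingleton (RedCohHomology K p ℓ) :=
  totExact_iff_subsingleton.1 <| TotExact.right
    (φ := fun _ => Submodule.inclusion coboundaries_le_cocycles) (ψ := fun _ => toRedCoh)
    (fun _ _ => rfl) (fun _ _ => rfl) (fun _ => Submodule.inclusion_injective _)
    (fun _ => exact_inclusion_toRedCoh) (fun _ => toRedCoh_surjective)
    totSqZero_resCocycles (totExact_iff_subsingleton.2 h) (totExact_iff_subsingleton.2 h')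

theorem dPrime_eq {ℓ ℓ' : ℤ} (h : ℓ' + 1 = ℓ) (x : CH K p ℓ) :
    dPrime K p h x =
      ((p + 1).negOnePow : ℤ) • totD (fun hJ => resCoh K hJ p) h x := by
  funext J
  simp only [dPrime, totD, LinearMap.pi_apply, LinearMap.smul_apply, LinearMap.sum_apply,
    LinearMap.comp_apply, LinearMap.proj_apply, LinearMap.coe_mk, AddHom.coe_mk, Pi.smul_apply]
  rfl

theorem HH.nonempty_equiv_redCohHomology (k ℓ : ℤ) :
    Nonempty (HH K k ℓ ≃ₗ[ℤ] RedCohHomology K (ℓ - k - 1) ℓ) := by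
  refine Homology.nonempty_equiv_of_iff (fun x => ?_) (fun x => ?_)
  · rw [dPrime_eq]
    rcases Int.units_eq_one_or (ℓ - k - 1 + 1).negOnePow with h | h <;> rw [h] <;> simp
  · simp_rw [dPrime_eq]
    rcases Int.units_eq_one_or (ℓ - k - 1 + 1).negOnePow with h | h <;> rw [h]
    · simp
    · constructor
      · rintro ⟨a, rfl⟩
        exact ⟨-a, by simp⟩
      · rintro ⟨a, rfl⟩
        exact ⟨-a, by simp⟩

end DoubleComplex

/-! ### Degrees without simplices, and cocycles in degree -1 -/

section Vanishing

variable {V : Type*} {K : AbstractSimplicialComplex V} {I : Finset V} {p : ℤ}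

theorem face_isEmpty_of_lt (hp : p < -1) : IsEmpty (Face K I p) :=
  ⟨fun s => by
    have := s.2.2.2
    omega⟩

theorem face_isEmpty_of_card_le {d : ℕ} (hK : ∀ s ∈ K, s.card ≤ d) (hp : (d : ℤ) ≤ p) :
    IsEmpty (Face K I p) := by
  refine ⟨fun s => ?_⟩
  have h := s.2.2.2
  rcases s.2.1 with h0 | h0
  · rw [h0, Finset.card_empty] at h
    omega
  · have := hK _ h0
    omega

variable [LinearOrder V]

theorem redCoh_subsingleton_of_coboundaries_eq_top (h : ∀ f : Cochain K I p, f ∈ coboundaries K I p) :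
    Subsingleton (RedCoh K I p) :=
  Homology.subsingleton_iff.2 fun f _ => h f

theorem redCoh_subsingleton_of_isEmpty [IsEmpty (Face K I p)] : Subsingleton (RedCoh K I p) :=
  redCoh_subsingleton_of_coboundaries_eq_top fun _ => ⟨0, Subsingleton.elim _ _⟩

theorem coboundaries_subsingleton_of_isEmpty [IsEmpty (Face K I p)] :
    Subsingleton (coboundaries K I p) :=
  inferInstance

/-- The coboundary of a (-1)-cochain takes on any vertex of `I` the value of the cochain on the
empty simplex. -/
theorem cocycles_neg_one_subsingleton (hI : I ≠ ∅) : Subsingleton (cocycles K I (-1)) := by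
  obtain ⟨v, hv⟩ := Finset.nonempty_iff_ne_empty.2 hI
  refine subsingleton_of_forall_eq 0 fun f => Subtype.ext <| funext fun s => ?_
  have hs : s.1 = ∅ := by simpa using s.2.2.2
  let t : Face K I 0 := ⟨{v}, Or.inr (K.singleton_mem v), by simpa using hv, by simp⟩
  have h : coboundary K I (neg_add_cancel 1) f.1 t = 0 :=
    congrFun ((coboundary_eq_zero_iff (neg_add_cancel 1) f.1).2 f.2) t
  have ht : t.1 = {v} := rfl
  rw [coboundary_apply_eq_sum, ht, Finset.sum_singleton, Finset.erase_singleton, ← hs,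
    Cochain.ext_apply] at h
  have he : eps v {v} = 1 := by simp [eps, Finset.filter_singleton]
  simpa [he] using h

theorem cocycles_neg_one_empty : Nonempty (cocycles K ∅ (-1) ≃ₗ[ℤ] ℤ) := by
  have : IsEmpty (Face K ∅ (-1 + 1)) := by
    refine ⟨fun s => ?_⟩
    have h := s.2.2.2
    rw [Finset.subset_empty.1 s.2.2.1] at h
    simp at h
  let e : Face K ∅ (-1) := ⟨∅, Or.inl rfl, Finset.Subset.rfl, rfl⟩
  have he : ∀ s : Face K ∅ (-1), s = e := fun s => Subtype.ext (Finset.subset_empty.1 s.2.2.1)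
  refine ⟨(AddEquiv.ofBijective ({ toFun f := f.1 e, map_zero' := rfl, map_add' _ _ := rfl } :
    cocycles K ∅ (-1) →+ ℤ) ⟨?_, ?_⟩).toIntLinearEquiv⟩
  · intro f g h
    refine Subtype.ext (funext fun s => ?_)
    rw [he s]
    exact h
  · exact fun x => ⟨⟨fun _ => x, Subsingleton.elim _ _⟩, rfl⟩

end Vanishing

/-! ### First cohomology of the full subcomplexes of a cycle -/

section Loop

/-- Partial sums integrate `ψ` around the cycle; since `i + 1` wraps around at the last index, the
total must vanish for the loop to close. -/
theorem exists_sub_eq_of_sum_eq_zero {n : ℕ} (ψ : Fin (n + 1) → ℤ) (h : ∑ i, ψ i = 0) :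
    ∃ g : Fin (n + 1) → ℤ, ∀ i, g (i + 1) - g i = ψ i := by
  refine ⟨fun k => ∑ j ∈ Finset.univ.filter (· < k), ψ j, fun i => ?_⟩
  beta_reduce
  induction i using Fin.lastCases with
  | last =>
    have h0 : Finset.univ.filter (· < (0 : Fin (n + 1))) = ∅ := by simp
    have h1 : Finset.univ.filter (· < Fin.last n) = Finset.univ.erase (Fin.last n) := by
      ext
      simp [Fin.lt_last_iff_ne_last]
    have h2 := Finset.add_sum_erase _ ψ (Finset.mem_univ (Fin.last n))
    rw [Fin.last_add_one, h0, h1, Finset.sum_empty]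
    omega
  | cast i =>
    have h1 : Finset.univ.filter (· < i.succ) =
        insert i.castSucc (Finset.univ.filter (· < i.castSucc)) := by
      ext j
      simp only [Finset.mem_filter, Finset.mem_univ, true_and, Finset.mem_insert, Fin.ext_iff,
        Fin.lt_def, Fin.val_succ, Fin.val_castSucc]
      omega
    rw [Fin.coeSucc_eq_succ, h1, Finset.sum_insert (by simp), add_sub_cancel_right]

variable {V : Type*} [LinearOrder V] {K : AbstractSimplicialComplex V} {n : ℕ}

/-- `c` runs through the vertices of the complex `K`, a cycle graph. -/
structure IsCycleEnum (K : AbstractSimplicialComplex V) (c : Fin (n + 3) ≃ V) : Prop where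
  card_le : ∀ s ∈ K, s.card ≤ 2
  edge_iff : ∀ s : Finset V, s ∈ K ∧ s.card = 2 ↔ ∃ i, s = {c i, c (i + 1)}

variable {c : Fin (n + 3) ≃ V} {I : Finset V} {p : ℤ}

theorem Cochain.ext_add (f g : Cochain K I p) (s : Finset V) :
    Cochain.ext (f + g) s = Cochain.ext f s + Cochain.ext g s := by
  unfold Cochain.ext
  split_ifs
  · rfl
  · simp

theorem Cochain.ext_zero (s : Finset V) : Cochain.ext (0 : Cochain K I p) s = 0 := by
  unfold Cochain.ext
  split_ifs <;> rfl

theorem eps_pair {a b : V} (h : a ≠ b) : eps b {a, b} = -eps a {a, b} := by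
  rw [Finset.pair_comm, eps_insert_self, Finset.pair_comm, eps_insert_self]
  rcases h.lt_or_gt with h | h <;> simp [eps, Finset.filter_singleton, h, h.not_gt]

theorem coboundary_pair (h : p + 1 = 1) (f : Cochain K I p) (s : Face K I 1) {a b : V}
    (hab : a ≠ b) (hs : s.1 = {a, b}) :
    coboundary K I h f s = eps a {a, b} * (Cochain.ext f {b} - Cochain.ext f {a}) := by
  have h1 : ({a, b} : Finset V).erase a = {b} := by
    rw [Finset.erase_insert (by simpa using hab)]
  have h2 : ({a, b} : Finset V).erase b = {a} := by
    rw [Finset.pair_comm, Finset.erase_insert (by simpa using hab.symm)]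
  rw [coboundary_apply_eq_sum, hs, Finset.sum_pair hab, h1, h2, eps_pair hab]
  ring

/-- The value of a 1-cochain on the `i`-th edge of the cycle, oriented along the cycle. -/
noncomputable def edgeValue (c : Fin (n + 3) ≃ V) (f : Cochain K I 1) (i : Fin (n + 3)) : ℤ :=
  eps (c i) {c i, c (i + 1)} * Cochain.ext f {c i, c (i + 1)}

/-- Integrating `ψ` gives a 0-cochain with coboundary `f`. At indices with `c i ∉ I` the `i`-th edge
is not in `K_I`, so `ψ` is free there and can be adjusted to have sum zero. -/
theorem IsCycleEnum.mem_coboundaries (hc : IsCycleEnum K c) (f : Cochain K I 1)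
    (ψ : Fin (n + 3) → ℤ) (hψ : ∑ i, ψ i = 0) (h : ∀ i, c i ∈ I → ψ i = edgeValue c f i) :
    f ∈ coboundaries K I 1 := by
  obtain ⟨g, hg⟩ := exists_sub_eq_of_sum_eq_zero ψ hψ
  -- A 0-simplex has one element, so the sum over `s.1` merely extracts it.
  refine (mem_coboundaries_iff (zero_add 1) f).2 ⟨fun s => ∑ v ∈ s.1, g (c.symm v), ?_⟩
  funext s
  have hv : ∀ v ∈ I, Cochain.ext (fun s : Face K I 0 => ∑ v ∈ s.1, g (c.symm v)) {v} =
      g (c.symm v) := by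
    intro v hv
    refine (Cochain.ext_apply _ (⟨{v}, Or.inr (K.singleton_mem v), by simpa using hv, by simp⟩ :
      Face K I 0)).trans ?_
    simp
  have hs2 : s.1.card = 2 := by
    have := s.2.2.2
    omega
  have hsK : s.1 ∈ K := by
    rcases s.2.1 with h | h
    · simp [h] at hs2
    · exact h
  obtain ⟨i, hi⟩ := (hc.edge_iff s.1).1 ⟨hsK, hs2⟩
  have hI := s.2.2.1
  rw [hi, Finset.insert_subset_iff, Finset.singleton_subset_iff] at hI
  rw [coboundary_pair _ _ s (by simp) hi, hv _ hI.1, hv _ hI.2, Equiv.symm_apply_apply,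
    Equiv.symm_apply_apply, hg, h i hI.1, edgeValue, ← mul_assoc, eps_mul_self, one_mul, ← hi,
    Cochain.ext_apply]

/-- The evaluation of a 1-cochain on the fundamental cycle. -/
noncomputable def loopSum (c : Fin (n + 3) ≃ V) : Cochain K I 1 →+ ℤ where
  toFun f := ∑ i, edgeValue c f i
  map_zero' := by simp [edgeValue, Cochain.ext_zero]
  map_add' f g := by simp [edgeValue, Cochain.ext_add, mul_add, Finset.sum_add_distrib]

theorem loopSum_apply (f : Cochain K I 1) : loopSum c f = ∑ i, edgeValue c f i :=
  rfl

variable [Fintype V]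

theorem IsCycleEnum.redCoh_one_subsingleton (hc : IsCycleEnum K c) (hI : I ≠ Finset.univ) :
    Subsingleton (RedCoh K I 1) := by
  refine redCoh_subsingleton_of_coboundaries_eq_top fun f => ?_
  obtain ⟨v, hv⟩ : ∃ v, v ∉ I := by
    by_contra! h
    exact hI (Finset.eq_univ_of_forall h)
  -- The index of the missing vertex `v` absorbs the total.
  refine hc.mem_coboundaries f
    (fun i => edgeValue c f i - if i = c.symm v then ∑ j, edgeValue c f j else 0) ?_ fun i hi => ?_
  · simp
  · rw [if_neg, sub_zero]
    rintro rfl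
    simp [hv] at hi

/-- The values of a coboundary on the oriented edges telescope around the loop; the converse is the
integration above with `ψ` equal to the edge values. -/
theorem IsCycleEnum.mem_coboundaries_iff (hc : IsCycleEnum K c)
    (f : Cochain K Finset.univ 1) : f ∈ coboundaries K Finset.univ 1 ↔ loopSum c f = 0 := by
  constructor
  · rintro ⟨g, rfl⟩
    have : ∀ i, edgeValue c (coboundary K Finset.univ (sub_add_cancel 1 1) g) i =
        Cochain.ext g {c (i + 1)} - Cochain.ext g {c i} := by
      intro i
      have hi := (hc.edge_iff {c i, c (i + 1)}).2 ⟨i, rfl⟩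
      let s : Face K Finset.univ 1 := ⟨{c i, c (i + 1)}, Or.inr hi.1, Finset.subset_univ _, by
        rw [hi.2]
        rfl⟩
      rw [edgeValue, Cochain.ext_apply _ s, coboundary_pair _ g s (by simp) rfl, ← mul_assoc,
        eps_mul_self, one_mul]
    rw [loopSum_apply, Finset.sum_congr rfl fun i _ => this i, Finset.sum_sub_distrib, sub_eq_zero]
    exact Equiv.sum_comp (Equiv.addRight (1 : Fin (n + 3))) fun i => Cochain.ext g {c i}
  · exact fun h => hc.mem_coboundaries f _ h fun _ _ => rfl

theorem IsCycleEnum.loopSum_surjective (hc : IsCycleEnum K c) :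
    Function.Surjective (loopSum c : Cochain K Finset.univ 1 →+ ℤ) := by
  intro k
  refine ⟨fun s => if s.1 = {c 0, c (0 + 1)} then eps (c 0) {c 0, c (0 + 1)} * k else 0, ?_⟩
  rw [loopSum_apply]
  refine (Finset.sum_eq_single 0 ?_ fun h => (h (Finset.mem_univ _)).elim).trans ?_
  · intro i _ hi
    have hne : ({c i, c (i + 1)} : Finset V) ≠ {c 0, c (0 + 1)} := by
      intro h
      have h1 : c i ∈ ({c 0, c (0 + 1)} : Finset V) := h ▸ Finset.mem_insert_self _ _
      have h2 : c (i + 1) ∈ ({c 0, c (0 + 1)} : Finset V) := h ▸ by simp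
      simp only [Finset.mem_insert, Finset.mem_singleton, EmbeddingLike.apply_eq_iff_eq, hi,
        false_or, zero_add] at h1 h2
      -- Now `i = 1`, and with at least three vertices `1 + 1` is neither `0` nor `1`.
      subst h1
      simp only [Fin.ext_iff, Fin.val_add, Fin.val_one, Fin.val_zero] at h2
      rw [Nat.mod_eq_of_lt (by omega)] at h2
      omega
    unfold edgeValue Cochain.ext
    split_ifs
    · exact (congrArg _ (if_neg hne)).trans (mul_zero _)
    · rw [mul_zero]
  · have hi := (hc.edge_iff {c 0, c (0 + 1)}).2 ⟨0, rfl⟩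
    let s : Face K Finset.univ 1 := ⟨{c 0, c (0 + 1)}, Or.inr hi.1, Finset.subset_univ _, by
      rw [hi.2]
      rfl⟩
    rw [edgeValue, Cochain.ext_apply _ s, if_pos rfl, ← mul_assoc, eps_mul_self, one_mul]

theorem IsCycleEnum.redCoh_one_univ (hc : IsCycleEnum K c) :
    Nonempty (RedCoh K Finset.univ 1 ≃ₗ[ℤ] ℤ) := by
  -- Without triangles every 1-cochain is a cocycle.
  have : IsEmpty (Face K Finset.univ (1 + 1)) := face_isEmpty_of_card_le hc.card_le le_rfl
  let F : cocycles K Finset.univ 1 →+ ℤ :=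
    (loopSum c).comp (cocycles K Finset.univ 1).subtype.toAddMonoidHom
  have hF : Function.Surjective F := by
    intro k
    obtain ⟨f, hf⟩ := hc.loopSum_surjective k
    exact ⟨⟨f, Subsingleton.elim _ _⟩, hf⟩
  have hk : (Homology.mk (coboundary K Finset.univ (sub_add_cancel 1 1))
      (coboundary K Finset.univ (rfl : 1 + 1 = (1 : ℤ) + 1))).ker = F.ker := by
    ext f
    exact (Homology.mk_eq_zero f).trans (hc.mem_coboundaries_iff f.1)
  exact ⟨((QuotientAddGroup.quotientKerEquivOfSurjective _ (Homology.mk_surjective _ _)).symm.trans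
    ((QuotientAddGroup.quotientAddEquivOfEq hk).trans
      (QuotientAddGroup.quotientKerEquivOfSurjective F hF))).toIntLinearEquiv⟩

end Loop

/-! ### From the cycle graph to a cyclic enumeration of its vertices -/

theorem IsCycleComplex.exists_isCycleEnum {n : ℕ} {L : AbstractSimplicialComplex (Fin (n + 3))}
    (hL : IsCycleComplex L) : ∃ c : Fin (n + 3) ≃ Fin (n + 3), IsCycleEnum L c := by
  obtain ⟨G, ⟨e⟩, rfl⟩ := hL
  have hmem : ∀ s, s ∈ Geometry.AbstractSimplicialComplex.ofSimpleGraph G ↔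
      (∃ v, s = {v}) ∨ ∃ x ∈ G.edgeSet, x.toFinset = s := fun s => Iff.rfl
  have hadj : ∀ i, G.Adj (e.symm i) (e.symm (i + 1)) := by
    intro i
    rw [e.symm.map_adj_iff, SimpleGraph.cycleGraph_adj]
    right
    simp
  refine ⟨e.symm.toEquiv, ?_, fun s => ⟨?_, ?_⟩⟩
  · intro s hs
    rcases (hmem s).1 hs with ⟨v, rfl⟩ | ⟨x, hx, rfl⟩
    · simp
    · rw [Sym2.card_toFinset]
      split_ifs <;> simp
  · rintro ⟨hs, hs2⟩
    rcases (hmem s).1 hs with ⟨v, rfl⟩ | ⟨x, hx, rfl⟩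
    · simp at hs2
    · induction x with | _ a b
      have h := e.map_adj_iff.2 (G.mem_edgeSet.1 hx)
      rw [SimpleGraph.cycleGraph_adj] at h
      rcases h with h | h
      · refine ⟨e b, ?_⟩
        rw [sub_eq_iff_eq_add'] at h
        rw [← h]
        simp [Sym2.toFinset_mk_eq, Finset.pair_comm]
      · refine ⟨e a, ?_⟩
        rw [sub_eq_iff_eq_add'] at h
        rw [← h]
        simp [Sym2.toFinset_mk_eq]
  · rintro ⟨i, rfl⟩
    refine ⟨(hmem _).2 (Or.inr ⟨s(e.symm i, e.symm (i + 1)), hadj i, ?_⟩), ?_⟩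
    · simp [Sym2.toFinset_mk_eq]
    · exact Finset.card_pair (hadj i).ne

/-! ### Homology of each family for the cycle -/

section Assembly

variable {V : Type*} [LinearOrder V] [Fintype V] {K : AbstractSimplicialComplex V} {ℓ : ℤ}

theorem cocycleHomology_neg_one_zero : Nonempty (CocycleHomology K (-1) 0 ≃ₗ[ℤ] ℤ) := by
  obtain ⟨E⟩ := TotHomology.nonempty_equiv_of_concentrated (M := fun I => cocycles K I (-1))
    (fun hJ => resCocycles hJ (-1)) (ℓ := 0) ∅ rfl fun _ hI => cocycles_neg_one_subsingleton hI
  obtain ⟨F⟩ := cocycles_neg_one_empty (K := K)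
  exact ⟨E.trans F⟩

theorem cocycleHomology_neg_one_subsingleton (hℓ : ℓ ≠ 0) :
    Subsingleton (CocycleHomology K (-1) ℓ) :=
  totExact_iff_subsingleton.1 <| totExact_of_subsingleton _ fun I hI =>
    cocycles_neg_one_subsingleton fun h => hℓ (by rw [← hI, h, Finset.card_empty, Nat.cast_zero])

theorem coboundaryHomology_subsingleton_of_isEmpty {p : ℤ} [∀ I : Finset V, IsEmpty (Face K I p)] :
    Subsingleton (CoboundaryHomology K p ℓ) :=
  totExact_iff_subsingleton.1 <| totExact_of_subsingleton _ fun _ _ =>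
    coboundaries_subsingleton_of_isEmpty

theorem redCohHomology_subsingleton_of_isEmpty {p : ℤ} [∀ I : Finset V, IsEmpty (Face K I p)] :
    Subsingleton (RedCohHomology K p ℓ) :=
  totExact_iff_subsingleton.1 <| totExact_of_subsingleton _ fun _ _ =>
    redCoh_subsingleton_of_isEmpty

theorem redCohHomology_neg_one_equiv :
    Nonempty (CocycleHomology K (-1) ℓ ≃ₗ[ℤ] RedCohHomology K (-1) ℓ) := by
  have : ∀ I, IsEmpty (Face K I (-1 - 1)) := fun I => face_isEmpty_of_lt (by norm_num)
  have h : ∀ k, Subsingleton (CoboundaryHomology K (-1) k) := fun k =>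
    totExact_iff_subsingleton.1 <| totExact_of_subsingleton _ fun I _ => by
      refine subsingleton_of_forall_eq 0 fun f => Subtype.ext ?_
      obtain ⟨g, hg⟩ := f.2
      rw [← hg, Subsingleton.elim g 0, map_zero]
      rfl
  exact RedCohHomology.nonempty_equiv_cocycleHomology (h _) (h _)

theorem coboundaryHomology_zero_equiv [Nonempty V] {ℓ' : ℤ} (h : ℓ' + 1 = ℓ) :
    Nonempty (CoboundaryHomology K 0 ℓ ≃ₗ[ℤ] CocycleHomology K (-1) ℓ') :=
  CoboundaryHomology.nonempty_equiv_cocycleHomology (neg_add_cancel 1)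
    (by simpa using Fintype.card_pos) h

theorem coboundaryHomology_zero_subsingleton [Nonempty V] (hℓ : ℓ ≠ 1) :
    Subsingleton (CoboundaryHomology K 0 ℓ) := by
  obtain ⟨E⟩ := coboundaryHomology_zero_equiv (K := K) (sub_add_cancel ℓ 1)
  have := cocycleHomology_neg_one_subsingleton (K := K) (ℓ := ℓ - 1) (by omega)
  exact E.toEquiv.subsingleton

variable {n : ℕ} {c : Fin (n + 3) ≃ V}

theorem IsCycleEnum.card_eq (_ : IsCycleEnum K c) : Fintype.card V = n + 3 := by
  simpa using (Fintype.card_congr c).symm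

theorem IsCycleEnum.redCohHomology_one_card (hc : IsCycleEnum K c) :
    Nonempty (RedCohHomology K 1 (n + 3) ≃ₗ[ℤ] ℤ) := by
  obtain ⟨E⟩ := TotHomology.nonempty_equiv_of_concentrated (M := fun I => RedCoh K I 1)
    (fun hJ => resCoh K hJ 1) (ℓ := n + 3) Finset.univ
    (by rw [Finset.card_univ, hc.card_eq]; push_cast; rfl) fun _ hI => hc.redCoh_one_subsingleton hI
  obtain ⟨F⟩ := hc.redCoh_one_univ
  exact ⟨E.trans F⟩

theorem IsCycleEnum.redCohHomology_one_subsingleton (hc : IsCycleEnum K c) (hℓ : ℓ ≠ n + 3) :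
    Subsingleton (RedCohHomology K 1 ℓ) :=
  totExact_iff_subsingleton.1 <| totExact_of_subsingleton _ fun I hI =>
    hc.redCoh_one_subsingleton fun h => hℓ (by
      rw [← hI, h, Finset.card_univ, hc.card_eq]
      push_cast
      rfl)

/-- There are no triangles, so `B^2 = 0` and `Z^1` is acyclic. The connecting maps from `H̃^1` to
`B^1` and from `B^1` to `Z^0` each lower `ℓ` by one. -/
theorem IsCycleEnum.cocycleHomology_zero_equiv (hc : IsCycleEnum K c) :
    Nonempty (CocycleHomology K 0 ℓ ≃ₗ[ℤ] RedCohHomology K 1 (ℓ + 2)) := by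
  have hcard := hc.card_eq
  have : ∀ I, IsEmpty (Face K I 2) := fun I => face_isEmpty_of_card_le hc.card_le le_rfl
  have h : ∀ k, Subsingleton (CocycleHomology K 1 k) := fun k => by
    obtain ⟨E⟩ := CoboundaryHomology.nonempty_equiv_cocycleHomology (K := K) (p := 1) (q := 2)
      rfl (by omega) (rfl : k + 1 = k + 1)
    have := coboundaryHomology_subsingleton_of_isEmpty (K := K) (p := 2) (ℓ := k + 1)
    exact E.symm.toEquiv.subsingleton
  obtain ⟨E⟩ := RedCohHomology.nonempty_equiv_coboundaryHomology (K := K) (p := 1)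
    (ℓ' := ℓ + 1) (ℓ := ℓ + 2) (by omega) (h _) (h _)
  obtain ⟨F⟩ := CoboundaryHomology.nonempty_equiv_cocycleHomology (K := K) (zero_add 1)
    (by omega) (rfl : ℓ + 1 = ℓ + 1)
  exact ⟨(E.trans F).symm⟩

theorem IsCycleEnum.cocycleHomology_zero_subsingleton (hc : IsCycleEnum K c) (hℓ : ℓ ≠ n + 1) :
    Subsingleton (CocycleHomology K 0 ℓ) := by
  obtain ⟨E⟩ := hc.cocycleHomology_zero_equiv (ℓ := ℓ)
  have := hc.redCohHomology_one_subsingleton (ℓ := ℓ + 2) (by omega)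
  exact E.toEquiv.subsingleton

/-- This class comes from the empty set through `B^0`. With `n ≥ 2` the homology of `Z^0`, in degree
`n + 1 ≥ 3`, misses the degrees 1 and 2 that could interfere. -/
theorem IsCycleEnum.redCohHomology_zero_two (hc : IsCycleEnum K c) (hn : 2 ≤ n) :
    Nonempty (RedCohHomology K 0 2 ≃ₗ[ℤ] ℤ) := by
  have : Nonempty V := ⟨c 0⟩
  obtain ⟨E⟩ := RedCohHomology.nonempty_equiv_coboundaryHomology (K := K) (p := 0) (ℓ := 2)
    (ℓ' := 1) rfl (hc.cocycleHomology_zero_subsingleton (by omega))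
    (hc.cocycleHomology_zero_subsingleton (by omega))
  obtain ⟨F⟩ := coboundaryHomology_zero_equiv (K := K) (zero_add 1)
  obtain ⟨H⟩ := cocycleHomology_neg_one_zero (K := K)
  exact ⟨E.trans (F.trans H)⟩

/-- This class comes from the fundamental class of the whole cycle through `Z^0`. The homology of
`B^0`, in degree 1, misses `n` and `n + 1` because `n ≥ 2`. -/
theorem IsCycleEnum.redCohHomology_zero_card_sub_two (hc : IsCycleEnum K c) (hn : 2 ≤ n) :
    Nonempty (RedCohHomology K 0 (n + 1) ≃ₗ[ℤ] ℤ) := by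
  have : Nonempty V := ⟨c 0⟩
  obtain ⟨E⟩ := RedCohHomology.nonempty_equiv_cocycleHomology (K := K) (p := 0) (ℓ := n + 1)
    (coboundaryHomology_zero_subsingleton (by omega))
    (coboundaryHomology_zero_subsingleton (by omega))
  obtain ⟨F⟩ := hc.cocycleHomology_zero_equiv (ℓ := n + 1)
  obtain ⟨H⟩ := hc.redCohHomology_one_card
  have h : (n : ℤ) + 1 + 2 = n + 3 := by ring
  rw [h] at F
  exact ⟨E.symm.trans (F.trans H)⟩

theorem IsCycleEnum.redCohHomology_zero_subsingleton (hc : IsCycleEnum K c) (h : ℓ ≠ 2)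
    (h' : ℓ ≠ n + 1) : Subsingleton (RedCohHomology K 0 ℓ) := by
  have : Nonempty V := ⟨c 0⟩
  exact RedCohHomology.subsingleton (hc.cocycleHomology_zero_subsingleton h')
    (coboundaryHomology_zero_subsingleton (by omega))

theorem IsCycleEnum.redCohHomology_equiv (hc : IsCycleEnum K c) (hn : 2 ≤ n) {p : ℤ}
    (h : (p = -1 ∧ ℓ = 0) ∨ (p = 0 ∧ ℓ = 2) ∨ (p = 0 ∧ ℓ = n + 1) ∨ (p = 1 ∧ ℓ = n + 3)) :
    Nonempty (RedCohHomology K p ℓ ≃ₗ[ℤ] ℤ) := by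
  rcases h with ⟨rfl, rfl⟩ | ⟨rfl, rfl⟩ | ⟨rfl, rfl⟩ | ⟨rfl, rfl⟩
  · obtain ⟨E⟩ := redCohHomology_neg_one_equiv (K := K) (ℓ := 0)
    obtain ⟨F⟩ := cocycleHomology_neg_one_zero (K := K)
    exact ⟨E.symm.trans F⟩
  · exact hc.redCohHomology_zero_two hn
  · exact hc.redCohHomology_zero_card_sub_two hn
  · exact hc.redCohHomology_one_card

theorem IsCycleEnum.redCohHomology_subsingleton (hc : IsCycleEnum K c) {p : ℤ}
    (h : ¬ ((p = -1 ∧ ℓ = 0) ∨ (p = 0 ∧ ℓ = 2) ∨ (p = 0 ∧ ℓ = n + 1) ∨ (p = 1 ∧ ℓ = n + 3))) :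
    Subsingleton (RedCohHomology K p ℓ) := by
  rcases lt_or_ge p (-1) with hp | hp
  · have : ∀ I, IsEmpty (Face K I p) := fun I => face_isEmpty_of_lt hp
    exact redCohHomology_subsingleton_of_isEmpty
  rcases le_or_gt 2 p with hp' | hp'
  · have : ∀ I, IsEmpty (Face K I p) := fun I => face_isEmpty_of_card_le hc.card_le hp'
    exact redCohHomology_subsingleton_of_isEmpty
  obtain rfl | rfl | rfl : p = -1 ∨ p = 0 ∨ p = 1 := by omega
  · obtain ⟨E⟩ := redCohHomology_neg_one_equiv (K := K) (ℓ := ℓ)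
    have := cocycleHomology_neg_one_subsingleton (K := K) (ℓ := ℓ) (by omega)
    exact E.symm.toEquiv.subsingleton
  · exact hc.redCohHomology_zero_subsingleton (by omega) (by omega)
  · exact hc.redCohHomology_one_subsingleton (by omega)

end Assembly

/-! ### The total group and the final statement -/

/-- A direct sum with exactly `n` nontrivial summands, all of rank one. -/
theorem directSum_nonempty_equiv_fin {ι : Type*} [DecidableEq ι] {M : ι → Type*}
    [∀ b, AddCommGroup (M b)] {n : ℕ} (b : Fin n → ι) (hb : Function.Injective b)
    (h : ∀ j, Nonempty (M (b j) ≃ₗ[ℤ] ℤ)) (h' : ∀ i, (∀ j, b j ≠ i) → Subsingleton (M i)) :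
    Nonempty (DirectSum ι M ≃ₗ[ℤ] (Fin n → ℤ)) := by
  have e := fun j => (h j).some
  let F : DirectSum ι M →+ (Fin n → ℤ) :=
    { toFun x j := e j (x (b j))
      map_zero' := by
        funext j
        simp
      map_add' x y := by
        funext j
        simp }
  refine ⟨(AddEquiv.ofBijective F ⟨?_, fun y => ?_⟩).toIntLinearEquiv⟩
  · refine (injective_iff_map_eq_zero _).2 fun x hx => DFinsupp.ext fun i => ?_
    by_cases hi : ∃ j, b j = i
    · obtain ⟨j, rfl⟩ := hi
      exact (e j).map_eq_zero_iff.1 (congrFun hx j)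
    · push Not at hi
      exact (h' i hi).elim _ _
  · refine ⟨∑ j, DirectSum.of M (b j) ((e j).symm (y j)), funext fun k => ?_⟩
    change e k ((∑ j, DirectSum.of M (b j) ((e j).symm (y j)) : DirectSum ι M) (b k)) = y k
    rw [DirectSum.sum_apply, Finset.sum_eq_single k]
    · rw [DirectSum.of_eq_same, LinearEquiv.apply_symm_apply]
    · intro j _ hj
      exact DirectSum.of_eq_of_ne _ _ _ fun h => hj (hb h).symm
    · simp

end DoubleCoh

theorem theorem7p2 (m : ℕ) (hm : 5 ≤ m) (L : AbstractSimplicialComplex (Fin m))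
    (hL : DoubleCoh.IsCycleComplex L) :
    (∀ k ℓ : ℤ,
      ((((-k, 2 * ℓ) : ℤ × ℤ) = (0, 0) ∨ ((-k, 2 * ℓ) : ℤ × ℤ) = (-1, 4) ∨
          ((-k, 2 * ℓ) : ℤ × ℤ) = (-(m : ℤ) + 3, 2 * ((m : ℤ) - 2)) ∨
          ((-k, 2 * ℓ) : ℤ × ℤ) = (-(m : ℤ) + 2, 2 * (m : ℤ))) →
        Nonempty (DoubleCoh.HH L k ℓ ≃ₗ[ℤ] ℤ)) ∧
      (¬ (((-k, 2 * ℓ) : ℤ × ℤ) = (0, 0) ∨ ((-k, 2 * ℓ) : ℤ × ℤ) = (-1, 4) ∨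
          ((-k, 2 * ℓ) : ℤ × ℤ) = (-(m : ℤ) + 3, 2 * ((m : ℤ) - 2)) ∨
          ((-k, 2 * ℓ) : ℤ × ℤ) = (-(m : ℤ) + 2, 2 * (m : ℤ))) →
        Subsingleton (DoubleCoh.HH L k ℓ))) ∧
    Nonempty ((DirectSum (ℤ × ℤ) fun b => DoubleCoh.HH L b.1 b.2) ≃ₗ[ℤ] (Fin 4 → ℤ)) := by
  obtain ⟨n, rfl⟩ : ∃ n, m = n + 3 := ⟨m - 3, by omega⟩
  obtain ⟨c, hc⟩ := hL.exists_isCycleEnum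
  have h1 : ∀ k ℓ : ℤ, ((k = 0 ∧ ℓ = 0) ∨ (k = 1 ∧ ℓ = 2) ∨ (k = n ∧ ℓ = n + 1) ∨
      (k = n + 1 ∧ ℓ = n + 3)) → Nonempty (DoubleCoh.HH L k ℓ ≃ₗ[ℤ] ℤ) := by
    intro k ℓ h
    obtain ⟨E⟩ := DoubleCoh.HH.nonempty_equiv_redCohHomology (K := L) k ℓ
    obtain ⟨F⟩ := hc.redCohHomology_equiv (by omega) (p := ℓ - k - 1) (ℓ := ℓ) (by omega)
    exact ⟨E.trans F⟩
  have h2 : ∀ k ℓ : ℤ, ¬ ((k = 0 ∧ ℓ = 0) ∨ (k = 1 ∧ ℓ = 2) ∨ (k = n ∧ ℓ = n + 1) ∨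
      (k = n + 1 ∧ ℓ = n + 3)) → Subsingleton (DoubleCoh.HH L k ℓ) := by
    intro k ℓ h
    obtain ⟨E⟩ := DoubleCoh.HH.nonempty_equiv_redCohHomology (K := L) k ℓ
    have := hc.redCohHomology_subsingleton (p := ℓ - k - 1) (ℓ := ℓ) (by omega)
    exact E.toEquiv.subsingleton
  refine ⟨fun k ℓ => ⟨fun h => h1 k ℓ ?_, fun h => h2 k ℓ ?_⟩, ?_⟩
  · simp only [Prod.mk.injEq] at h
    push_cast at h
    omega
  · simp only [Prod.mk.injEq] at h
    push_cast at h
    omega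
  -- The four nonzero positions are listed as pairs `(k, ℓ)`, not as bidegrees `(-k, 2ℓ)`, with `n =
  -- m - 3`.
  · refine DoubleCoh.directSum_nonempty_equiv_fin
      ![(0, 0), (1, 2), ((n : ℤ), (n : ℤ) + 1), ((n : ℤ) + 1, (n : ℤ) + 3)] ?_ ?_ ?_
    · intro i j h
      fin_cases i <;> fin_cases j <;> simp at h ⊢ <;> omega
    · intro j
      fin_cases j <;> exact h1 _ _ (by simp)
    · rintro ⟨k, ℓ⟩ h
      refine h2 k ℓ ?_
      have e0 := h 0
      have e1 := h 1
      have e2 := h 2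
      have e3 := h 3
      simp only [Matrix.cons_val, ne_eq, Prod.mk.injEq] at e0 e1 e2 e3
      omega
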